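/- A two-dimensional rigid body moves in an unbounded plane ideal incompressible fluid of density $\rho>0$, with constant circulation $\Gamma\neq 0$ of the fluid velocity around the body. The body (mass $M>0$, central moment of inertia $I>0$) carries a particle of mass $m>0$, fixed in the body, and a rotor (mass $m_r>0$, central moment of inertia $I_r>0$) rotating relative to the body with angular velocity $\Omega(t)$. The body frame $O_1\xi\eta$ has its origin $O_1$ at the center of mass of the pair body–rotor; in this frame the centers of mass of the body and of the rotor and the particle are at $(\xi_b,\eta_b)$, $(\xi_r,\eta_r)$ and $(\xi,\eta)$, with $M\xi_b+m_r\xi_r=0=M\eta_b+m_r\eta_r$. Let $\lambda_1\neq\lambda_2$ be the added masses, $\lambda_6$ the added moment of inertia (all $\ge 0$), $\mu,\nu\in\mathbb R$ the coefficients of hydrodynamical asymmetry, and put $$a_i=M+m+m_r+\lambda_i\ (i=1,2),\qquad f=-m\eta,\quad g=m\xi,\qquad \lambda=\rho\Gamma,\quad \zeta=\rho\Gamma\mu,\quad \chi=\rho\Gamma\nu,$$ $$b=M(\xi_b^2+\eta_b^2)+I+m(\xi^2+\eta^2)+m_r(\xi_r^2+\eta_r^2)+I_r+\lambda_6 .$$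 Let $(x,y)$ be the position of $O_1$ in the plane, $\alpha\in\mathbb R/2\pi\mathbb Z$ the angle of rotation of the body frame, $(v_1,v_2)$ the components of the velocity of $O_1$ along the body axes and $\omega$ the angular velocity. With $P_1=a_1v_1+f\omega$, $P_2=a_2v_2+g\omega$, $P_3=fv_1+gv_2+b\omega+I_r\Omega$ the equations of motion are $$\dot x=v_1\cos\alpha-v_2\sin\alpha,\quad \dot y=v_1\sin\alpha+v_2\cos\alpha,\quad \dot\alpha=\omega,$$ $$\dot P_1=\omega P_2-\lambda v_2-\zeta\omega,\quad \dot P_2=-\omega P_1+\lambda v_1+\chi\omega,\quad \dot P_3=v_2P_1-v_1P_2+\zeta v_1-\chi v_2,$$ and they preserve $$p_x=(P_1-\chi)\cos\alpha-(P_2-\zeta)\sin\alpha+\lambda y,\qquad p_y=(P_1-\chi)\sin\alpha+(P_2-\zeta)\cos\alpha-\lambda x,$$ $$K=P_3+\tfrac{\lambda}{2}(x^2+y^2)+xp_y-yp_x .$$ **Theorem.** Let an initial position $(x_0,y_0,\alpha_0)$, an initial velocity of the body $(v_1,v_2,\omega)$, an initial angular velocity $\Omega_0$ of the rotor, and an end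 position $(x_1,y_1,\alpha_1)$ be given. In the exceptional case that $a_1\nu=f$ and $a_2\mu=g$, assume moreover that neither of the two positions $(x,y,\alpha)$ lies on the curve $$x+\mu\cos\alpha+\nu\sin\alpha=-p_y/\lambda,\qquad y+\mu\sin\alpha-\nu\cos\alpha=p_x/\lambda,$$ where $p_x,p_y$ are the values of the integrals at the initial state. Then there are a time $T>0$, a $C^\infty$ function $\Omega$ with $\Omega(0)=\Omega_0$, and a solution of the equations of motion on $[0,T]$ with this $\Omega$, starting at the given initial position and velocity and staying on the level set of $p_x$, $p_y$, $K$ determined by the initial data, which at time $T$ is in the position $(x_1,y_1,\alpha_1)$ (the angle modulo $2\pi$). -/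

import Mathlib

/-- The position of the body: the coordinates `(x, y)` of the origin `O₁` of the body frame in the
fixed frame, and the angle `α` from the fixed frame to the body frame (a real representative). -/
structure BodyPosition where
  x : ℝ
  y : ℝ
  α : ℝ

/-- The velocity of the body: the components `(v₁, v₂)`, along the axes of the body frame, of the
absolute velocity of `O₁`, and the angular velocity `ω`. -/
structure BodyVelocity where
  v₁ : ℝ
  v₂ : ℝ
  ω : ℝ

/-- A two-dimensional body in an ideal fluid, carrying a particle that is fixed in the body and a
rotor. The origin of the body frame is the centre of mass of the pair (body, rotor). -/
structure BodyInFluid where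
  /-- mass of the body -/
  M : ℝ
  /-- central moment of inertia of the body -/
  I : ℝ
  /-- mass of the internal particle -/
  m : ℝ
  /-- mass of the rotor -/
  mr : ℝ
  /-- central moment of inertia of the rotor -/
  Ir : ℝ
  /-- added masses -/
  lam₁ : ℝ
  lam₂ : ℝ
  /-- added moment of inertia -/
  lam₆ : ℝ
  /-- position of the centre of mass of the body, in the body frame -/
  ξb : ℝ
  ηb : ℝ
  /-- position of the centre of mass of the rotor, in the body frame -/
  ξr : ℝ
  ηr : ℝ
  /-- position of the internal particle, in the body frame -/
  ξ : ℝ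
  η : ℝ
  /-- density of the fluid -/
  ρ : ℝ
  /-- circulation of the fluid velocity around the body -/
  Γ : ℝ
  /-- coefficients of hydrodynamical asymmetry -/
  μ : ℝ
  ν : ℝ
  M_pos : 0 < M
  I_pos : 0 < I
  m_pos : 0 < m
  mr_pos : 0 < mr
  Ir_pos : 0 < Ir
  lam₁_nonneg : 0 ≤ lam₁
  lam₂_nonneg : 0 ≤ lam₂
  lam₆_nonneg : 0 ≤ lam₆
  ρ_pos : 0 < ρ
  centre_ξ : M * ξb + mr * ξr = 0
  centre_η : M * ηb + mr * ηr = 0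

namespace BodyInFluid

noncomputable section

variable (B : BodyInFluid)

def a₁ : ℝ := B.M + B.m + B.mr + B.lam₁

def a₂ : ℝ := B.M + B.m + B.mr + B.lam₂

def b : ℝ :=
  B.M * (B.ξb ^ 2 + B.ηb ^ 2) + B.I + B.m * (B.ξ ^ 2 + B.η ^ 2)
    + B.mr * (B.ξr ^ 2 + B.ηr ^ 2) + B.Ir + B.lam₆

def f : ℝ := -(B.m * B.η)

def g : ℝ := B.m * B.ξ

/-- `λ = ρ Γ` -/
def lam : ℝ := B.ρ * B.Γ

/-- `ζ = ρ Γ μ` -/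
def ζ : ℝ := B.ρ * B.Γ * B.μ

/-- `χ = ρ Γ ν` -/
def χ : ℝ := B.ρ * B.Γ * B.ν

/-- `∂T/∂v₁` -/
def P₁ (w : BodyVelocity) : ℝ := B.a₁ * w.v₁ + B.f * w.ω

/-- `∂T/∂v₂` -/
def P₂ (w : BodyVelocity) : ℝ := B.a₂ * w.v₂ + B.g * w.ω

/-- `∂T/∂ω`, for angular velocity `Ω` of the rotor -/
def P₃ (w : BodyVelocity) (Ω : ℝ) : ℝ := B.f * w.v₁ + B.g * w.v₂ + B.b * w.ω + B.Ir * Ω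

/-- The momentum integral `p_x`. -/
def px (q : BodyPosition) (w : BodyVelocity) : ℝ :=
  (B.P₁ w - B.χ) * Real.cos q.α - (B.P₂ w - B.ζ) * Real.sin q.α + B.lam * q.y

/-- The momentum integral `p_y`. -/
def py (q : BodyPosition) (w : BodyVelocity) : ℝ :=
  (B.P₁ w - B.χ) * Real.sin q.α + (B.P₂ w - B.ζ) * Real.cos q.α - B.lam * q.x

/-- The angular momentum integral `K`. -/
def K (q : BodyPosition) (w : BodyVelocity) (Ω : ℝ) : ℝ :=
  B.P₃ w Ω + B.lam / 2 * (q.x ^ 2 + q.y ^ 2) + q.x * B.py q w - q.y * B.px q w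

/-- `(q, w)` is a motion of the system on the time interval `[0, T]` when the rotor rotates with
angular velocity `Ω(t)`: the kinematic relations and the equations of motion hold there. -/
structure IsMotion (T : ℝ) (Ω : ℝ → ℝ) (q : ℝ → BodyPosition) (w : ℝ → BodyVelocity) : Prop where
  x_eq : ∀ t ∈ Set.Icc 0 T, HasDerivWithinAt (fun s => (q s).x)
    ((w t).v₁ * Real.cos (q t).α - (w t).v₂ * Real.sin (q t).α) (Set.Icc 0 T) t
  y_eq : ∀ t ∈ Set.Icc 0 T, HasDerivWithinAt (fun s => (q s).y)
    ((w t).v₁ * Real.sin (q t).α + (w t).v₂ * Real.cos (q t).α) (Set.Icc 0 T) t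
  α_eq : ∀ t ∈ Set.Icc 0 T, HasDerivWithinAt (fun s => (q s).α) (w t).ω (Set.Icc 0 T) t
  P₁_eq : ∀ t ∈ Set.Icc 0 T, HasDerivWithinAt (fun s => B.P₁ (w s))
    ((w t).ω * B.P₂ (w t) - B.lam * (w t).v₂ - B.ζ * (w t).ω) (Set.Icc 0 T) t
  P₂_eq : ∀ t ∈ Set.Icc 0 T, HasDerivWithinAt (fun s => B.P₂ (w s))
    (-((w t).ω * B.P₁ (w t)) + B.lam * (w t).v₁ + B.χ * (w t).ω) (Set.Icc 0 T) t
  P₃_eq : ∀ t ∈ Set.Icc 0 T, HasDerivWithinAt (fun s => B.P₃ (w s) (Ω s))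
    ((w t).v₂ * B.P₁ (w t) - (w t).v₁ * B.P₂ (w t) + B.ζ * (w t).v₁ - B.χ * (w t).v₂)
    (Set.Icc 0 T) t

/-- The degenerate case in which the hydrodynamical asymmetry is cancelled by the position of the
internal particle: in the body frame that makes the inertia matrix diagonal, both coefficients of
asymmetry vanish. -/
def Balanced : Prop := B.a₁ * B.ν = B.f ∧ B.a₂ * B.μ = B.g

/-- On the level `p_x = c₁`, `p_y = c₂`, the point of the body with body coordinates `(μ, -ν)`
is at the point `(-c₂ / λ, c₁ / λ)` of the plane. -/
def AtCentre (c₁ c₂ : ℝ) (q : BodyPosition) : Prop :=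
  q.x + (B.μ * Real.cos q.α + B.ν * Real.sin q.α) = -c₂ / B.lam ∧
    q.y + (B.μ * Real.sin q.α - B.ν * Real.cos q.α) = c₁ / B.lam

end

end BodyInFluid

/-! ### Smooth extension and scalar linear equations -/

section SmoothAnalysis

open Filter Set
open scoped ContDiff Topology Manifold

/-! The rotor makes the angular velocity a free control. On a level set of `px`, `py` the momenta
`P₁`, `P₂`, and with them `v₁`, `v₂` for given ω, are determined by the vector from the fixed point
(-p_y/λ, p_x/λ) to O₁ in body axes. Because I_r > 0, the level of `K` can be solved for Ω whatever ω
is, and the third equation of motion then holds automatically (`isMotion_of_hasDerivAt`). After a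
shift the vector becomes a complex number z with z' = i d z̄ + c - i(ω - s) z, where s and d are
half the sum and half the difference of λ/a₂ and λ/a₁. It remains to steer z between two given
points with ω(0) prescribed and with ∫ω prescribed modulo 2π (`PlanarSystem.exists_trajectory`).

The control only rotates z. In polar coordinates r' = d sin(2φ) r + Re(c e^{-iφ}) does not contain
ω, while the angular equation determines ω from any chosen smooth φ, as long as r > 0. Since λ₁ ≠ λ₂
gives d ≠ 0, there are rays on which r grows without bound and rays on which it shrinks. Turning
quickly between rays costs only a bounded factor in r, so any two nonzero states can be joined
(`exists_steers`).

To adjust ∫ω, the trajectory pauses at a relative equilibrium with constant ω ≠ 0; one exists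
because s² - d² = λ²/(a₁a₂) > 0 (`exists_equilibrium`). The origin is left by its drift c when c ≠
0; c = 0 forces the exceptional case, where z = 0 would put the position on the excluded curve.

Smooth joining is handled by prescribing whole germs, not just values, at the ends of each leg. -/

theorem contDiff_infty_of_hasDerivAt {F : Type*} [NormedAddCommGroup F] [NormedSpace ℝ F]
    {f f' : ℝ → F} (h : ∀ t, HasDerivAt f (f' t) t) (hf' : ContDiff ℝ ∞ f') : ContDiff ℝ ∞ f := by
  rw [contDiff_infty_iff_deriv]
  refine ⟨fun t => (h t).differentiableAt, ?_⟩
  rwa [show deriv f = f' from funext fun t => (h t).deriv]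

theorem hasDerivAt_integral_of_continuous {F : Type*} [NormedAddCommGroup F] [NormedSpace ℝ F]
    [CompleteSpace F] {f : ℝ → F} (hf : Continuous f) (a t : ℝ) :
    HasDerivAt (fun u => ∫ x in a..u, f x) (f t) t :=
  intervalIntegral.integral_hasDerivAt_right (hf.intervalIntegrable _ _)
    hf.stronglyMeasurable.stronglyMeasurableAtFilter hf.continuousAt

theorem contDiff_infty_integral {F : Type*} [NormedAddCommGroup F] [NormedSpace ℝ F]
    [CompleteSpace F] {f : ℝ → F} (hf : ContDiff ℝ ∞ f) (a : ℝ) :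
    ContDiff ℝ ∞ (fun u => ∫ x in a..u, f x) :=
  contDiff_infty_of_hasDerivAt (fun t => hasDerivAt_integral_of_continuous hf.continuous a t) hf

/-- A function that is smooth near a compact set agrees near that set with a smooth function. -/
theorem exists_contDiff_extension {F : Type*} [NormedAddCommGroup F] [NormedSpace ℝ F]
    {f : ℝ → F} {s : Set ℝ} (hs : IsCompact s)
    (hf : ∀ t ∈ s, ∀ᶠ τ in 𝓝 t, ContDiffAt ℝ ∞ f τ) :
    ∃ g : ℝ → F, ContDiff ℝ ∞ g ∧ ∀ t ∈ s, g =ᶠ[𝓝 t] f := by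
  obtain ⟨L, hL, hsL, hLU⟩ := exists_compact_between hs
    (isOpen_interior (s := {τ | ContDiffAt ℝ ∞ f τ}))
    (fun t ht => mem_interior_iff_mem_nhds.2 (hf t ht))
  obtain ⟨χ, hχ1, hχ0, -⟩ := exists_contMDiffMap_one_nhds_of_subset_interior (n := (⊤ : ℕ∞)) 𝓘(ℝ, ℝ)
    hs.isClosed hsL
  have hχ : ContDiff ℝ ∞ (fun t => χ t) := contMDiff_iff_contDiff.1 χ.contMDiff
  -- Off `L` nothing is known about `f`, but the cutoff vanishes there.
  refine ⟨fun t => χ t • f t, contDiff_iff_contDiffAt.2 fun t => ?_, fun t ht => ?_⟩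
  · by_cases ht : t ∈ L
    · exact hχ.contDiffAt.smul (interior_subset (hLU ht))
    · have : (fun t => χ t • f t) =ᶠ[𝓝 t] fun _ => 0 := by
        filter_upwards [hL.isClosed.isOpen_compl.mem_nhds ht] with τ hτ
        rw [hχ0 τ hτ, zero_smul]
      exact contDiffAt_const.congr_of_eventuallyEq this
  · filter_upwards [hχ1.filter_mono (nhds_le_nhdsSet ht)] with τ hτ
    rw [hτ, one_smul]

/-- Continuity bounds `a` near `t₀`, which gives a uniform Lipschitz constant. This uniqueness
identifies germs of radii at the ends of legs. -/
theorem eventuallyEq_of_linear_ode {a b r₁ r₂ : ℝ → ℝ} {t₀ : ℝ} (ha : ContinuousAt a t₀)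
    (h₁ : ∀ᶠ t in 𝓝 t₀, HasDerivAt r₁ (a t * r₁ t + b t) t)
    (h₂ : ∀ᶠ t in 𝓝 t₀, HasDerivAt r₂ (a t * r₂ t + b t) t) (h : r₁ t₀ = r₂ t₀) :
    r₁ =ᶠ[𝓝 t₀] r₂ := by
  have hb : ∀ᶠ t in 𝓝 t₀, ‖a t‖ < ‖a t₀‖ + 1 :=
    ha.norm.eventually (gt_mem_nhds (by linarith))
  refine ODE_solution_unique_of_eventually (v := fun t x => a t * x + b t)
    (s := fun _ => univ) (K := ‖a t₀‖₊ + 1) ?_ (h₁.mono fun t h => ⟨h, mem_univ _⟩)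
    (h₂.mono fun t h => ⟨h, mem_univ _⟩) h
  filter_upwards [hb] with t ht
  refine LipschitzWith.lipschitzOnWith (LipschitzWith.of_dist_le_mul fun x y => ?_)
  simp only [dist_add_right, NNReal.coe_add, coe_nnnorm, NNReal.coe_one]
  rw [Real.dist_eq, Real.dist_eq, ← mul_sub, abs_mul]
  exact mul_le_mul_of_nonneg_right ht.le (abs_nonneg _)

/-- The solution of `r' = a r + b` with initial value `r₀` at time `0`. -/
noncomputable def linearSolution (a b : ℝ → ℝ) (r₀ t : ℝ) : ℝ :=
  Real.exp (∫ x in (0 : ℝ)..t, a x) *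
    (r₀ + ∫ u in (0 : ℝ)..t, Real.exp (-∫ x in (0 : ℝ)..u, a x) * b u)

section

variable {a b : ℝ → ℝ} (r₀ : ℝ)

@[simp] theorem linearSolution_zero : linearSolution a b r₀ 0 = r₀ := by simp [linearSolution]

theorem continuous_exp_neg_integral_mul (ha : Continuous a) (hb : Continuous b) :
    Continuous fun u => Real.exp (-∫ x in (0 : ℝ)..u, a x) * b u :=
  (Real.continuous_exp.comp (intervalIntegral.continuous_primitive
    (fun _ _ => ha.intervalIntegrable _ _) 0).neg).mul hb

theorem hasDerivAt_linearSolution (ha : Continuous a) (hb : Continuous b) (t : ℝ) :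
    HasDerivAt (linearSolution a b r₀) (a t * linearSolution a b r₀ t + b t) t := by
  have h1 := (hasDerivAt_integral_of_continuous ha 0 t).exp
  have h2 := (hasDerivAt_integral_of_continuous (continuous_exp_neg_integral_mul ha hb) 0 t).const_add
    r₀
  refine (h1.mul h2).congr_deriv ?_
  have : Real.exp (∫ x in (0 : ℝ)..t, a x) * (Real.exp (-∫ x in (0 : ℝ)..t, a x) * b t) = b t := by
    rw [← mul_assoc, ← Real.exp_add, add_neg_cancel, Real.exp_zero, one_mul]
  rw [this, linearSolution]
  ring

theorem contDiff_linearSolution (ha : ContDiff ℝ ∞ a) (hb : ContDiff ℝ ∞ b) :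
    ContDiff ℝ ∞ (linearSolution a b r₀) := by
  have h := contDiff_infty_integral ha 0
  exact h.exp.mul (contDiff_const.add (contDiff_infty_integral (h.neg.exp.mul hb) 0))

/-- A solution of `r' = a r + b` with `|a| ≤ D`, `|b| ≤ C` does not drop far in a short time. -/
theorem le_linearSolution {C D t : ℝ}
    (hC : ∀ t, |b t| ≤ C) (hD : ∀ t, |a t| ≤ D) (ht : 0 ≤ t) (ht1 : t ≤ 1)
    (hr : C * Real.exp D * t ≤ r₀ / 2) (hr₀ : 0 ≤ r₀) :
    Real.exp (-D) * (r₀ / 2) ≤ linearSolution a b r₀ t := by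
  have hint : ∀ u, 0 ≤ u → u ≤ 1 → |∫ x in (0 : ℝ)..u, a x| ≤ D := fun u hu hu1 => by
    have h := intervalIntegral.norm_integral_le_of_norm_le_const (a := 0) (b := u) (f := a) (C := D)
      (fun x _ => hD x)
    have hD0 : 0 ≤ D := (abs_nonneg _).trans (hD 0)
    rw [Real.norm_eq_abs, sub_zero, abs_of_nonneg hu] at h
    nlinarith
  have h2 : |∫ u in (0 : ℝ)..t, Real.exp (-∫ x in (0 : ℝ)..u, a x) * b u| ≤ C * Real.exp D * t := by
    have h := intervalIntegral.norm_integral_le_of_norm_le_const (a := 0) (b := t)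
      (f := fun u => Real.exp (-∫ x in (0 : ℝ)..u, a x) * b u) (C := C * Real.exp D) (fun u hu => by
        rw [uIoc_of_le ht] at hu
        rw [Real.norm_eq_abs, abs_mul, abs_of_pos (Real.exp_pos _), mul_comm]
        refine mul_le_mul (hC u) (Real.exp_le_exp.2 ?_) (Real.exp_pos _).le
          ((abs_nonneg _).trans (hC u))
        exact (neg_le_abs _).trans (hint u hu.1.le (hu.2.trans ht1)))
    rwa [Real.norm_eq_abs, sub_zero, abs_of_nonneg ht] at h
  refine mul_le_mul (Real.exp_le_exp.2 ?_) ?_ (by positivity) (Real.exp_pos _).le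
  · linarith [neg_abs_le (∫ x in (0 : ℝ)..t, a x), hint t ht ht1]
  · linarith [neg_abs_le (∫ u in (0 : ℝ)..t, Real.exp (-∫ x in (0 : ℝ)..u, a x) * b u)]

end

/-- With constant coefficients `a > 0`, `b ≥ 0`, the solution grows at least exponentially. -/
theorem le_linearSolution_const {a b r₀ t : ℝ} (hb : 0 ≤ b) (hr₀ : 0 ≤ r₀)
    (ht : 0 ≤ t) : r₀ * (1 + a * t) ≤ linearSolution (fun _ => a) (fun _ => b) r₀ t := by
  have h : 0 ≤ ∫ u in (0 : ℝ)..t, Real.exp (-∫ _ in (0 : ℝ)..u, a) * b :=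
    intervalIntegral.integral_nonneg ht fun u _ => by positivity
  have h1 : 1 + a * t ≤ Real.exp (∫ _ in (0 : ℝ)..t, a) := by
    rw [intervalIntegral.integral_const, smul_eq_mul, sub_zero]
    linarith [Real.add_one_le_exp (t * a)]
  rw [linearSolution]
  calc r₀ * (1 + a * t) ≤ Real.exp (∫ _ in (0 : ℝ)..t, a) * r₀ := by
        rw [mul_comm]; exact mul_le_mul_of_nonneg_right h1 hr₀
    _ ≤ _ := mul_le_mul_of_nonneg_left (by linarith) (Real.exp_pos _).le

end SmoothAnalysis

/-- The controlled planar system `z' = i d z̄ + c - i (w - s) z` with scalar control `w`. -/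
structure PlanarSystem where
  s : ℝ
  d : ℝ
  c : ℂ

namespace PlanarSystem

open Filter Set
open scoped ContDiff Topology ComplexConjugate

def field (S : PlanarSystem) (w : ℝ) (z : ℂ) : ℂ :=
  Complex.I * S.d * conj z + S.c - Complex.I * (w - S.s) * z

/-- The system with the direction of time reversed. -/
def reverse (S : PlanarSystem) : PlanarSystem := ⟨-S.s, -S.d, -S.c⟩

/-- Near time `t`, the curve `z` is a smooth trajectory for the smooth control `w`. -/
def IsSolutionNear (S : PlanarSystem) (z : ℝ → ℂ) (w : ℝ → ℝ) (t : ℝ) : Prop :=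
  ∀ᶠ τ in 𝓝 t, ContDiffAt ℝ ∞ z τ ∧ ContDiffAt ℝ ∞ w τ ∧ HasDerivAt z (S.field (w τ) (z τ)) τ

/-- A controlled trajectory leads from the germ of `(z₀, w₀)` at `0` to the germ of `(z₁, w₁)`
at `0`, the integral of the control being `Δ`. -/
def Steers (S : PlanarSystem) (z₀ : ℝ → ℂ) (w₀ : ℝ → ℝ) (z₁ : ℝ → ℂ) (w₁ : ℝ → ℝ) (Δ : ℝ) :
    Prop :=
  ∃ T > 0, ∃ z w, (∀ t ∈ Icc 0 T, S.IsSolutionNear z w t) ∧ z =ᶠ[𝓝 0] z₀ ∧ w =ᶠ[𝓝 0] w₀ ∧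
    (fun t => z (T + t)) =ᶠ[𝓝 0] z₁ ∧ (fun t => w (T + t)) =ᶠ[𝓝 0] w₁ ∧
    ∫ t in (0 : ℝ)..T, w t = Δ

variable {S : PlanarSystem} {z z' z₀ z₁ z₂ : ℝ → ℂ} {w w' w₀ w₁ w₂ : ℝ → ℝ} {t Δ Δ₁ Δ₂ : ℝ}

@[simp] theorem reverse_reverse : S.reverse.reverse = S := by simp [reverse]

/-- The control changes sign along with `s`, `d`, `c`, so a reversed leg contributes the negative of
its integral. -/
theorem field_reverse (w : ℝ) (z : ℂ) : S.reverse.field (-w) z = -S.field w z := by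
  simp only [field, reverse, Complex.ofReal_neg]
  ring

theorem IsSolutionNear.congr (h : S.IsSolutionNear z w t) (hz : z' =ᶠ[𝓝 t] z)
    (hw : w' =ᶠ[𝓝 t] w) : S.IsSolutionNear z' w' t := by
  filter_upwards [h, hz.eventually_nhds, hw.eventually_nhds] with τ ⟨h1, h2, h3⟩ hz hw
  refine ⟨h1.congr_of_eventuallyEq hz, h2.congr_of_eventuallyEq hw, ?_⟩
  rw [hz.self_of_nhds, hw.self_of_nhds]
  exact h3.congr_of_eventuallyEq hz

theorem IsSolutionNear.comp_const_add (a : ℝ) (h : S.IsSolutionNear z w (a + t)) :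
    S.IsSolutionNear (fun τ => z (a + τ)) (fun τ => w (a + τ)) t := by
  have hc : Tendsto (fun τ => a + τ) (𝓝 t) (𝓝 (a + t)) :=
    (continuous_const.add continuous_id).continuousAt
  filter_upwards [hc.eventually h] with τ ⟨h1, h2, h3⟩
  have hs : ContDiffAt ℝ ∞ (fun τ : ℝ => a + τ) τ := contDiffAt_const.add contDiffAt_id
  exact ⟨h1.comp τ hs, h2.comp τ hs, h3.comp_const_add a τ⟩

theorem IsSolutionNear.reverse (a : ℝ) (h : S.IsSolutionNear z w (a - t)) :
    S.reverse.IsSolutionNear (fun τ => z (a - τ)) (fun τ => -w (a - τ)) t := by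
  have hc : Tendsto (fun τ => a - τ) (𝓝 t) (𝓝 (a - t)) :=
    (continuous_const.sub continuous_id).continuousAt
  filter_upwards [hc.eventually h] with τ ⟨h1, h2, h3⟩
  have hs : ContDiffAt ℝ ∞ (fun τ : ℝ => a - τ) τ := contDiffAt_const.sub contDiffAt_id
  refine ⟨h1.comp τ hs, (h2.comp τ hs).neg, ?_⟩
  rw [field_reverse]
  exact h3.comp_const_sub a τ

/-- A global trajectory steers between any two of its germs. -/
theorem steers_of_isSolutionNear {T : ℝ} (hT : 0 < T)
    (h : ∀ t ∈ Icc 0 T, S.IsSolutionNear z w t) :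
    S.Steers z w (fun t => z (T + t)) (fun t => w (T + t)) (∫ t in (0 : ℝ)..T, w t) :=
  ⟨T, hT, z, w, h, .rfl, .rfl, .rfl, .rfl, rfl⟩

theorem Steers.congr_right (h : S.Steers z₀ w₀ z w Δ) (hz : z =ᶠ[𝓝 0] z₁) (hw : w =ᶠ[𝓝 0] w₁) :
    S.Steers z₀ w₀ z₁ w₁ Δ := by
  obtain ⟨T, hT, y, u, h, h1, h2, h3, h4, h5⟩ := h
  exact ⟨T, hT, y, u, h, h1, h2, h3.trans hz, h4.trans hw, h5⟩

theorem Steers.congr_left (h : S.Steers z w z₁ w₁ Δ) (hz : z =ᶠ[𝓝 0] z₀) (hw : w =ᶠ[𝓝 0] w₀) :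
    S.Steers z₀ w₀ z₁ w₁ Δ := by
  obtain ⟨T, hT, y, u, h, h1, h2, h3, h4, h5⟩ := h
  exact ⟨T, hT, y, u, h, h1.trans hz, h2.trans hw, h3, h4, h5⟩

theorem Steers.isSolutionNear_left (h : S.Steers z₀ w₀ z₁ w₁ Δ) : S.IsSolutionNear z₀ w₀ 0 := by
  obtain ⟨T, hT, y, u, h, h1, h2, -⟩ := h
  exact (h 0 ⟨le_rfl, hT.le⟩).congr h1.symm h2.symm

/-- Two functions joined at time `T`. -/
noncomputable def concat {F : Type*} (T : ℝ) (y y' : ℝ → F) (t : ℝ) : F :=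
  if t ≤ T then y t else y' (t - T)

section concat

variable {F : Type*} {T : ℝ} {y y' y₁ : ℝ → F}

/-- At the junction both branches have the common germ `y₁`, so it does not matter which one the
`if` selects. -/
theorem concat_eventuallyEq_left (h : (fun t => y (T + t)) =ᶠ[𝓝 0] y₁) (h' : y' =ᶠ[𝓝 0] y₁)
    (ht : t ≤ T) : concat T y y' =ᶠ[𝓝 t] y := by
  rcases ht.lt_or_eq with ht | rfl
  · filter_upwards [gt_mem_nhds ht] with τ hτ
    exact if_pos hτ.le
  · have hc : Tendsto (fun τ => τ - t) (𝓝 t) (𝓝 0) :=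
      Continuous.tendsto' (by fun_prop) _ _ (by simp)
    filter_upwards [hc.eventually h, hc.eventually h'] with τ h1 h2
    unfold concat
    split_ifs
    · rfl
    · simp only [add_sub_cancel] at h1
      rw [h1, h2]

theorem concat_eventuallyEq_right (h : (fun t => y (T + t)) =ᶠ[𝓝 0] y₁) (h' : y' =ᶠ[𝓝 0] y₁)
    (ht : T ≤ t) : concat T y y' =ᶠ[𝓝 t] fun τ => y' (τ - T) := by
  rcases ht.lt_or_eq with ht | rfl
  · filter_upwards [lt_mem_nhds ht] with τ hτ
    exact if_neg (not_le.2 hτ)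
  · have hc : Tendsto (fun τ => τ - T) (𝓝 T) (𝓝 0) :=
      Continuous.tendsto' (by fun_prop) _ _ (by simp)
    filter_upwards [hc.eventually h, hc.eventually h'] with τ h1 h2
    unfold concat
    split_ifs
    · simp only [add_sub_cancel] at h1
      rw [h1, h2]
    · rfl

end concat

/-- Near each time the concatenation coincides with one of the two legs, suitably translated.
Smoothness and the equation are local, so they carry over, even at the junction. -/
theorem Steers.trans (h : S.Steers z₀ w₀ z₁ w₁ Δ₁) (h' : S.Steers z₁ w₁ z₂ w₂ Δ₂) :
    S.Steers z₀ w₀ z₂ w₂ (Δ₁ + Δ₂) := by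
  obtain ⟨T, hT, y, u, hs, hy0, hu0, hy1, hu1, hi⟩ := h
  obtain ⟨T', hT', y', u', hs', hy0', hu0', hy1', hu1', hi'⟩ := h'
  have hshift : ∀ {F : Type} {g g' g₁ : ℝ → F}, (fun t => g (T + t)) =ᶠ[𝓝 0] g₁ → g' =ᶠ[𝓝 0] g₁ →
      (fun t => concat T g g' (T + T' + t)) =ᶠ[𝓝 0] fun t => g' (T' + t) := by
    intro F g g' g₁ h1 h2
    have hc : Tendsto (fun t => T + T' + t) (𝓝 0) (𝓝 (T + T')) :=
      Continuous.tendsto' (by fun_prop) _ _ (by simp)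
    filter_upwards [hc.eventually (concat_eventuallyEq_right h1 h2 (t := T + T') (by linarith))]
      with t ht
    rw [ht]
    congr 1
    ring
  have hint : ∀ a b, a ∈ Icc 0 (T + T') → b ∈ Icc 0 (T + T') →
      IntervalIntegrable (concat T u u') MeasureTheory.volume a b := by
    intro a b ha hb
    refine ContinuousOn.intervalIntegrable fun t ht => ContinuousAt.continuousWithinAt ?_
    have ht := uIcc_subset_Icc ha hb ht
    rcases le_total t T with h | h
    · exact ((hs t ⟨ht.1, h⟩).self_of_nhds.2.1.continuousAt).congr
        (concat_eventuallyEq_left hu1 hu0' h).symm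
    · have h3 := (hs' (t - T) ⟨by linarith, by linarith [ht.2]⟩).self_of_nhds.2.1.continuousAt
      exact (ContinuousAt.comp (f := fun τ => τ - T) (x := t) h3
        (continuous_id.sub continuous_const).continuousAt).congr
        (concat_eventuallyEq_right hu1 hu0' h).symm
  refine ⟨T + T', by linarith, concat T y y', concat T u u', fun t ht => ?_, ?_, ?_, ?_, ?_, ?_⟩
  · rcases le_total t T with h | h
    · exact (hs t ⟨ht.1, h⟩).congr (concat_eventuallyEq_left hy1 hy0' h)
        (concat_eventuallyEq_left hu1 hu0' h)
    · have h3 := IsSolutionNear.comp_const_add (t := t) (-T)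
        (hs' (-T + t) ⟨by linarith, by linarith [ht.2]⟩)
      simp only [neg_add_eq_sub] at h3
      exact h3.congr (concat_eventuallyEq_right hy1 hy0' h) (concat_eventuallyEq_right hu1 hu0' h)
  · exact (concat_eventuallyEq_left hy1 hy0' hT.le).trans hy0
  · exact (concat_eventuallyEq_left hu1 hu0' hT.le).trans hu0
  · exact (hshift hy1 hy0').trans hy1'
  · exact (hshift hu1 hu0').trans hu1'
  · rw [← intervalIntegral.integral_add_adjacent_intervals (b := T)
      (hint _ _ ⟨le_rfl, by linarith⟩ ⟨hT.le, by linarith⟩)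
      (hint _ _ ⟨hT.le, by linarith⟩ ⟨by linarith, le_rfl⟩), ← hi, ← hi']
    congr 1
    · refine intervalIntegral.integral_congr fun t ht => ?_
      rw [uIcc_of_le hT.le] at ht
      exact (concat_eventuallyEq_left hu1 hu0' ht.2).eq_of_nhds
    · have h4 := intervalIntegral.integral_comp_sub_right (a := T) (b := T + T') u' T
      rw [sub_self, add_sub_cancel_left] at h4
      rw [← h4]
      refine intervalIntegral.integral_congr fun t ht => ?_
      rw [uIcc_of_le (by linarith)] at ht
      exact (concat_eventuallyEq_right hu1 hu0' ht.1).eq_of_nhds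

theorem Steers.reverse (h : S.Steers z₀ w₀ z₁ w₁ Δ) :
    S.reverse.Steers (fun t => z₁ (-t)) (fun t => -w₁ (-t)) (fun t => z₀ (-t)) (fun t => -w₀ (-t))
      (-Δ) := by
  obtain ⟨T, hT, y, u, hs, hy0, hu0, hy1, hu1, hi⟩ := h
  have hc : Tendsto (fun t : ℝ => -t) (𝓝 0) (𝓝 0) :=
    Continuous.tendsto' (by fun_prop) _ _ (by simp)
  refine ⟨T, hT, fun t => y (T - t), fun t => -u (T - t), fun t ht => ?_, ?_, ?_, ?_, ?_, ?_⟩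
  · exact (hs (T - t) ⟨by linarith [ht.2], by linarith [ht.1]⟩).reverse T
  · exact hc.eventually hy1
  · filter_upwards [hc.eventually hu1] with t ht
    rw [sub_eq_add_neg, ht]
  · filter_upwards [hc.eventually hy0] with t ht
    rw [sub_add_cancel_left, ht]
  · filter_upwards [hc.eventually hu0] with t ht
    rw [sub_add_cancel_left, ht]
  · rw [intervalIntegral.integral_neg, intervalIntegral.integral_comp_sub_left, sub_self, sub_zero,
      hi]

end PlanarSystem

/-! ### Polar coordinates: the argument as the new control -/

namespace PlanarSystem

open Filter Set
open scoped ContDiff Topology ComplexConjugate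

/-- In polar coordinates `z = r exp (iφ)` the radius satisfies `r' = radialGain φ * r + radialDrift φ`
whatever the control. -/
noncomputable def radialGain (S : PlanarSystem) (φ : ℝ) : ℝ := S.d * Real.sin (2 * φ)

noncomputable def radialDrift (S : PlanarSystem) (φ : ℝ) : ℝ :=
  S.c.re * Real.cos φ + S.c.im * Real.sin φ

/-- The velocity of the argument, for zero control, in the frame rotating with rate `-s`. -/
noncomputable def angularRate (S : PlanarSystem) (φ r : ℝ) : ℝ :=
  S.s + S.d * Real.cos (2 * φ) + (S.c.im * Real.cos φ - S.c.re * Real.sin φ) / r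

noncomputable def polarCurve (φ r : ℝ → ℝ) (t : ℝ) : ℂ :=
  (r t * Real.cos (φ t) : ℝ) + (r t * Real.sin (φ t) : ℝ) * Complex.I

/-- The control that produces the trajectory `polarCurve φ r`. -/
noncomputable def polarControl (S : PlanarSystem) (φ r : ℝ → ℝ) (t : ℝ) : ℝ :=
  S.angularRate (φ t) (r t) - deriv φ t

variable {S : PlanarSystem} {z : ℝ → ℂ} {w φ φ' r r' : ℝ → ℝ} {t : ℝ}

theorem contDiff_radialGain : ContDiff ℝ ∞ S.radialGain :=
  contDiff_const.mul (Real.contDiff_sin.comp (contDiff_const.mul contDiff_id))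

theorem contDiff_radialDrift : ContDiff ℝ ∞ S.radialDrift :=
  (contDiff_const.mul Real.contDiff_cos).add (contDiff_const.mul Real.contDiff_sin)

theorem abs_radialGain_le (φ : ℝ) : |S.radialGain φ| ≤ |S.d| := by
  rw [radialGain, abs_mul]
  exact mul_le_of_le_one_right (abs_nonneg _) (Real.abs_sin_le_one _)

theorem abs_radialDrift_le (φ : ℝ) : |S.radialDrift φ| ≤ |S.c.re| + |S.c.im| := by
  refine (abs_add_le _ _).trans (add_le_add ?_ ?_) <;> rw [abs_mul]
  · exact mul_le_of_le_one_right (abs_nonneg _) (Real.abs_cos_le_one _)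
  · exact mul_le_of_le_one_right (abs_nonneg _) (Real.abs_sin_le_one _)

theorem polarCurve_congr (hφ : φ =ᶠ[𝓝 t] φ') (hr : r =ᶠ[𝓝 t] r') :
    polarCurve φ r =ᶠ[𝓝 t] polarCurve φ' r' := by
  filter_upwards [hφ, hr] with τ h1 h2
  rw [polarCurve, polarCurve, h1, h2]

theorem polarControl_congr (hφ : φ =ᶠ[𝓝 t] φ') (hr : r =ᶠ[𝓝 t] r') :
    S.polarControl φ r =ᶠ[𝓝 t] S.polarControl φ' r' := by
  filter_upwards [hφ, hr, hφ.deriv] with τ h1 h2 h3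
  rw [polarControl, polarControl, h1, h2, h3]

theorem polarControl_comp_const_add (φ r : ℝ → ℝ) (a t : ℝ) :
    S.polarControl φ r (a + t) = S.polarControl (fun t => φ (a + t)) (fun t => r (a + t)) t := by
  rw [polarControl, polarControl, deriv_comp_const_add]

theorem field_polarCurve (w : ℝ) (t : ℝ) : S.field w (polarCurve φ r t) =
    ((S.d + (w - S.s)) * r t * Real.sin (φ t) + S.c.re : ℝ) +
      ((S.d - (w - S.s)) * r t * Real.cos (φ t) + S.c.im : ℝ) * Complex.I := by
  apply Complex.ext <;> simp [field, polarCurve, -Complex.ofReal_cos, -Complex.ofReal_sin] <;> ring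

theorem hasDerivAt_polarCurve {φ₁ r₁ : ℝ} (hφ : HasDerivAt φ φ₁ t) (hr : HasDerivAt r r₁ t) :
    HasDerivAt (polarCurve φ r)
      ((r₁ * Real.cos (φ t) - r t * φ₁ * Real.sin (φ t) : ℝ) +
        (r₁ * Real.sin (φ t) + r t * φ₁ * Real.cos (φ t) : ℝ) * Complex.I) t := by
  have h1 := (hr.mul hφ.cos).ofReal_comp
  have h2 := (hr.mul hφ.sin).ofReal_comp
  refine (h1.add (h2.mul_const Complex.I)).congr_deriv ?_
  congr 2
  · ring
  · congr 1; ring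

/-- The control term is tangential, so the radial equation is free of it. The angular equation is
solved for the control, which requires dividing by `r`. -/
theorem isSolutionNear_polarCurve (hφ : ContDiff ℝ ∞ φ) (hr : ContDiff ℝ ∞ r)
    (hd : ∀ t, HasDerivAt r (S.radialGain (φ t) * r t + S.radialDrift (φ t)) t) (h0 : r t ≠ 0) :
    S.IsSolutionNear (polarCurve φ r) (S.polarControl φ r) t := by
  filter_upwards [hr.continuous.continuousAt.eventually_ne h0] with τ hτ
  have hφ' := (contDiff_infty_iff_deriv.1 hφ)
  refine ⟨?_, ?_, ?_⟩
  · have h1 : ContDiff ℝ ∞ fun t => ((r t * Real.cos (φ t) : ℝ) : ℂ) :=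
      Complex.ofRealCLM.contDiff.comp (hr.mul hφ.cos)
    have h2 : ContDiff ℝ ∞ fun t => ((r t * Real.sin (φ t) : ℝ) : ℂ) :=
      Complex.ofRealCLM.contDiff.comp (hr.mul hφ.sin)
    exact (h1.add (h2.mul contDiff_const)).contDiffAt
  · have h1 : ContDiff ℝ ∞ fun t => S.c.im * Real.cos (φ t) - S.c.re * Real.sin (φ t) :=
      (contDiff_const.mul hφ.cos).sub (contDiff_const.mul hφ.sin)
    have h2 : ContDiff ℝ ∞ fun t => S.s + S.d * Real.cos (2 * φ t) :=
      contDiff_const.add (contDiff_const.mul (contDiff_const.mul hφ).cos)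
    exact (h2.contDiffAt.add (h1.contDiffAt.div hr.contDiffAt hτ)).sub hφ'.2.contDiffAt
  · refine (hasDerivAt_polarCurve (hφ'.1 τ).hasDerivAt (hd τ)).congr_deriv ?_
    rw [field_polarCurve]
    have hw : (S.polarControl φ r τ - S.s) * r τ = S.d * Real.cos (2 * φ τ) * r τ +
        (S.c.im * Real.cos (φ τ) - S.c.re * Real.sin (φ τ)) - deriv φ τ * r τ := by
      rw [polarControl, angularRate]
      field_simp
      ring
    rw [Real.cos_two_mul'] at hw
    have hcs := Real.sin_sq_add_cos_sq (φ τ)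
    congr 2
    · rw [radialGain, radialDrift, Real.sin_two_mul]
      linear_combination (-Real.sin (φ τ)) * hw +
        (S.d * r τ * Real.sin (φ τ) + S.c.re) * hcs
    · congr 1
      rw [radialGain, radialDrift, Real.sin_two_mul]
      linear_combination (Real.cos (φ τ)) * hw +
        (S.d * r τ * Real.cos (φ τ) + S.c.im) * hcs

/-- Away from the origin every trajectory has polar coordinates. -/
theorem IsSolutionNear.exists_polar (h : S.IsSolutionNear z w 0) (hz : z 0 ≠ 0) :
    ∃ φ r : ℝ → ℝ, ContDiff ℝ ∞ φ ∧ r 0 = ‖z 0‖ ∧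
      (∀ᶠ t in 𝓝 0, HasDerivAt r (S.radialGain (φ t) * r t + S.radialDrift (φ t)) t) ∧
      z =ᶠ[𝓝 0] polarCurve φ r ∧ w =ᶠ[𝓝 0] S.polarControl φ r := by
  have hcont : ContinuousAt z 0 := h.self_of_nhds.1.continuousAt
  -- Dividing by `z 0` makes the logarithm start at 1, away from its branch cut.
  set l : ℝ → ℂ := fun t => Complex.log (z t / z 0) with hl
  have hslit : ∀ᶠ t in 𝓝 0, z t / z 0 ∈ Complex.slitPlane := by
    refine (hcont.div_const (z 0)).eventually (Complex.isOpen_slitPlane.mem_nhds ?_)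
    simp [hz]
  set φ₀ : ℝ → ℝ := fun t => Complex.arg (z 0) + (l t).im with hφ₀
  set r : ℝ → ℝ := fun t => ‖z 0‖ * Real.exp (l t).re with hr
  have hφs : ∀ᶠ t in 𝓝 0, ContDiffAt ℝ ∞ φ₀ t := by
    filter_upwards [h, hslit] with t ⟨h1, _, _⟩ h2
    have h3 : ContDiffAt ℝ ∞ l t :=
      ContDiffAt.comp (g := Complex.log) t ((Complex.contDiffAt_log h2).restrict_scalars ℝ)
        (h1.div_const (z 0))
    exact contDiffAt_const.add (Complex.imCLM.contDiff.contDiffAt.comp t h3)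
  -- The argument is smooth only near 0; a global version is needed for later blending with a
  -- constant angle.
  obtain ⟨φ, hφ, hφe⟩ := exists_contDiff_extension (s := {(0 : ℝ)}) isCompact_singleton
    (fun t ht => by rw [mem_singleton_iff.1 ht]; exact hφs)
  replace hφe := hφe 0 rfl
  have hpol : ∀ᶠ t in 𝓝 0, z t = polarCurve φ r t := by
    filter_upwards [hcont.eventually_ne hz, hφe] with t h1 h2
    have h3 : z t = z 0 * Complex.exp (l t) := by
      rw [hl, Complex.exp_log (div_ne_zero h1 hz), mul_div_cancel₀ _ hz]
    have h4 : z 0 = ‖z 0‖ * Complex.exp (Complex.arg (z 0) * Complex.I) :=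
      (Complex.norm_mul_exp_arg_mul_I _).symm
    have h5 : z t = ((r t : ℝ) : ℂ) * Complex.exp ((φ t : ℝ) * Complex.I) := by
      rw [h3, h2, hr, hφ₀]
      nth_rewrite 1 [h4]
      nth_rewrite 1 [← Complex.re_add_im (l t)]
      rw [mul_assoc, ← Complex.exp_add]
      push_cast
      rw [mul_assoc, ← Complex.exp_add]
      congr 2
      ring
    rw [h5, polarCurve, Complex.exp_mul_I]
    push_cast
    ring
  have hderiv : ∀ᶠ t in 𝓝 0, 0 < r t ∧
      HasDerivAt r (S.radialGain (φ t) * r t + S.radialDrift (φ t)) t ∧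
      deriv φ t * r t = S.d * Real.cos (2 * φ t) * r t +
        (S.c.im * Real.cos (φ t) - S.c.re * Real.sin (φ t)) - (w t - S.s) * r t := by
    filter_upwards [h, hslit, hpol, hcont.eventually_ne hz, hφe.eventually_nhds]
      with t ⟨_, _, h1⟩ h2 h3 h4 h5
    have hrt : 0 < r t := mul_pos (norm_pos_iff.2 hz) (Real.exp_pos _)
    have hld : HasDerivAt l (S.field (w t) (z t) / z t) t := by
      refine ((h1.div_const (z 0)).clog_real h2).congr_deriv ?_
      field_simp
    -- The logarithmic derivative z'/z has real part r'/r and imaginary part φ'.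
    set q := S.field (w t) (z t) / z t with hq
    have hfield : q * z t = S.field (w t) (z t) := div_mul_cancel₀ _ h4
    rw [h3, field_polarCurve, polarCurve] at hfield
    have hre := congrArg Complex.re hfield
    have him := congrArg Complex.im hfield
    simp only [Complex.add_re, Complex.mul_re, Complex.ofReal_re, Complex.ofReal_im,
      Complex.add_im, Complex.mul_im, Complex.I_re, Complex.I_im] at hre him
    have hrd : HasDerivAt r (‖z 0‖ * (Real.exp (l t).re * q.re)) t :=
      ((Complex.reCLM.hasFDerivAt.comp_hasDerivAt t hld).exp).const_mul _
    have hφd : HasDerivAt φ q.im t :=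
      ((Complex.imCLM.hasFDerivAt.comp_hasDerivAt t hld).const_add _).congr_of_eventuallyEq h5
    have hcs := Real.sin_sq_add_cos_sq (φ t)
    refine ⟨hrt, hrd.congr_deriv ?_, ?_⟩
    · rw [← mul_assoc, radialGain, radialDrift, Real.sin_two_mul]
      change r t * q.re = _
      linear_combination Real.cos (φ t) * hre + Real.sin (φ t) * him - q.re * r t * hcs
    · rw [hφd.deriv, Real.cos_two_mul']
      linear_combination Real.cos (φ t) * him - Real.sin (φ t) * hre -
        (q.im * r t + (w t - S.s) * r t) * hcs
  refine ⟨φ, r, hφ, by simp [hr, hl, hz], hderiv.mono fun t h => h.2.1, hpol, ?_⟩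
  filter_upwards [hderiv] with t ⟨h1, _, h2⟩
  rw [polarControl, angularRate]
  field_simp
  linear_combination h2

end PlanarSystem

/-! ### Controllability of the planar system -/

namespace PlanarSystem

open Filter Set
open scoped ContDiff Topology ComplexConjugate

noncomputable def rayRadius (S : PlanarSystem) (φ r₀ : ℝ) : ℝ → ℝ :=
  linearSolution (fun _ => S.radialGain φ) (fun _ => S.radialDrift φ) r₀

/-- The trajectory with constant argument `φ` that is at distance `r₀` at time `0`. -/
noncomputable def rayCurve (S : PlanarSystem) (φ r₀ : ℝ) : ℝ → ℂ :=
  polarCurve (fun _ => φ) (S.rayRadius φ r₀)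

noncomputable def rayControl (S : PlanarSystem) (φ r₀ : ℝ) : ℝ → ℝ :=
  S.polarControl (fun _ => φ) (S.rayRadius φ r₀)

variable {S : PlanarSystem} {z z₀ z₁ : ℝ → ℂ} {w w₀ w₁ : ℝ → ℝ} {φ r₀ r₁ : ℝ}

@[simp] theorem rayRadius_zero : S.rayRadius φ r₀ 0 = r₀ := linearSolution_zero _

theorem hasDerivAt_rayRadius (φ r₀ t : ℝ) : HasDerivAt (S.rayRadius φ r₀)
    (S.radialGain φ * S.rayRadius φ r₀ t + S.radialDrift φ) t :=
  hasDerivAt_linearSolution r₀ continuous_const continuous_const t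

theorem contDiff_rayRadius : ContDiff ℝ ∞ (S.rayRadius φ r₀) :=
  contDiff_linearSolution r₀ contDiff_const contDiff_const

theorem isSolutionNear_ray {t : ℝ} (h : S.rayRadius φ r₀ t ≠ 0) :
    S.IsSolutionNear (S.rayCurve φ r₀) (S.rayControl φ r₀) t :=
  isSolutionNear_polarCurve contDiff_const contDiff_rayRadius (hasDerivAt_rayRadius φ r₀) h

theorem rayCurve_zero_ne_zero (h : 0 < r₀) : S.rayCurve φ r₀ 0 ≠ 0 := by
  intro h0
  have hre := congrArg Complex.re h0
  have him := congrArg Complex.im h0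
  simp [rayCurve, polarCurve, h.ne', -Complex.ofReal_cos, -Complex.ofReal_sin] at hre him
  simpa [hre, him] using Real.sin_sq_add_cos_sq φ

theorem norm_rayCurve_zero (h : 0 ≤ r₀) : ‖S.rayCurve φ r₀ 0‖ = r₀ := by
  have h1 : S.rayCurve φ r₀ 0 = r₀ * Complex.exp (φ * Complex.I) := by
    rw [Complex.exp_mul_I, rayCurve, polarCurve, rayRadius_zero]
    push_cast
    ring
  rw [h1, norm_mul, Complex.norm_exp_ofReal_mul_I, mul_one, Complex.norm_real, Real.norm_of_nonneg h]

/-- A polar trajectory whose argument is constant near time `T` continues along a ray. -/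
theorem polar_eventuallyEq_ray {ψ R : ℝ → ℝ} {T : ℝ} (hψ : ψ =ᶠ[𝓝 T] fun _ => φ)
    (hR : ∀ᶠ t in 𝓝 T, HasDerivAt R (S.radialGain (ψ t) * R t + S.radialDrift (ψ t)) t) :
    (fun t => polarCurve ψ R (T + t)) =ᶠ[𝓝 0] S.rayCurve φ (R T) ∧
      (fun t => S.polarControl ψ R (T + t)) =ᶠ[𝓝 0] S.rayControl φ (R T) := by
  have hc : Tendsto (fun t => T + t) (𝓝 0) (𝓝 T) :=
    Continuous.tendsto' (by fun_prop) _ _ (by simp)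
  have h1 : (fun t => ψ (T + t)) =ᶠ[𝓝 0] fun _ => φ := hc.eventually hψ
  have h2 : (fun t => R (T + t)) =ᶠ[𝓝 0] S.rayRadius φ (R T) := by
    refine eventuallyEq_of_linear_ode (a := fun _ => S.radialGain φ) (b := fun _ => S.radialDrift φ)
      continuousAt_const ?_ (Eventually.of_forall (hasDerivAt_rayRadius φ (R T))) (by simp)
    filter_upwards [hc.eventually hR, h1] with t h3 h4
    rw [h4] at h3
    exact h3.comp_const_add T t
  refine ⟨polarCurve_congr h1 h2, ?_⟩
  simp only [polarControl_comp_const_add]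
  exact polarControl_congr h1 h2

/-- Reversal negates gain and drift but keeps the ray, so contracting rays are reversed expanding
ones. -/
theorem reverse_ray_eventuallyEq (φ r₀ : ℝ) :
    (fun t => S.reverse.rayCurve φ r₀ (-t)) =ᶠ[𝓝 0] S.rayCurve φ r₀ ∧
      (fun t => -S.reverse.rayControl φ r₀ (-t)) =ᶠ[𝓝 0] S.rayControl φ r₀ := by
  have h : (fun t => S.reverse.rayRadius φ r₀ (-t)) =ᶠ[𝓝 0] S.rayRadius φ r₀ := by
    refine eventuallyEq_of_linear_ode (a := fun _ => S.radialGain φ) (b := fun _ => S.radialDrift φ)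
      continuousAt_const (Eventually.of_forall fun t => ?_)
      (Eventually.of_forall (hasDerivAt_rayRadius φ r₀)) (by simp)
    refine ((hasDerivAt_rayRadius (S := S.reverse) φ r₀ (-t)).comp t (hasDerivAt_neg t)).congr_deriv ?_
    simp only [radialGain, radialDrift, reverse, Complex.neg_re, Complex.neg_im]
    ring
  refine ⟨polarCurve_congr .rfl h, ?_⟩
  filter_upwards [h] with t ht
  simp only [rayControl, polarControl, deriv_const, ht, angularRate]
  simp only [reverse, Complex.neg_re, Complex.neg_im]
  ring

/-- From a state other than the origin one can turn onto any ray in an arbitrarily short time. -/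
theorem IsSolutionNear.exists_steers_ray (h : S.IsSolutionNear z w 0) (hz : z 0 ≠ 0) (φ : ℝ) :
    ∃ r₁ ≥ Real.exp (-|S.d|) * (‖z 0‖ / 2), ∃ Δ,
      S.Steers z w (S.rayCurve φ r₁) (S.rayControl φ r₁) Δ := by
  obtain ⟨ψ, r, hψ, hr0, hr, hzr, hwr⟩ := h.exists_polar hz
  have hρ : 0 < ‖z 0‖ := norm_pos_iff.2 hz
  set C := |S.c.re| + |S.c.im| with hC
  have hCE : 0 ≤ C * Real.exp |S.d| := by positivity
  -- The turn is so short that the drift can consume at most half of the radius.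
  obtain ⟨τ, hτ0, hτ1, hτ⟩ : ∃ τ > 0, τ ≤ 1 ∧ C * Real.exp |S.d| * τ ≤ ‖z 0‖ / 2 := by
    refine ⟨min 1 (‖z 0‖ / 2 / (C * Real.exp |S.d| + 1)), by positivity, min_le_left _ _, ?_⟩
    calc _ ≤ (C * Real.exp |S.d| + 1) * (‖z 0‖ / 2 / (C * Real.exp |S.d| + 1)) := by
          gcongr
          · linarith
          · exact min_le_right _ _
      _ = _ := mul_div_cancel₀ _ (by positivity)
  -- The angle follows `ψ` up to τ/3 and equals `φ` from 2τ/3 on, so both end germs are exact.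
  set θ : ℝ → ℝ := fun t => ψ t + Real.smoothTransition (3 * t / τ - 1) * (φ - ψ t) with hθ
  have hθs : ContDiff ℝ ∞ θ := by
    have h1 : ContDiff ℝ ∞ fun t : ℝ => 3 * t / τ - 1 :=
      ((contDiff_const.mul contDiff_id).div_const τ).sub contDiff_const
    exact hψ.add ((Real.smoothTransition.contDiff.comp h1).mul (contDiff_const.sub hψ))
  have hθ0 : θ =ᶠ[𝓝 0] ψ := by
    filter_upwards [gt_mem_nhds (show (0 : ℝ) < τ / 3 by positivity)] with t ht
    have : 3 * t / τ - 1 ≤ 0 := by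
      rw [sub_nonpos, div_le_one hτ0]; linarith
    simp [hθ, Real.smoothTransition.zero_of_nonpos this]
  have hθ1 : θ =ᶠ[𝓝 τ] fun _ => φ := by
    filter_upwards [lt_mem_nhds (show 2 * τ / 3 < τ by linarith)] with t ht
    have : 1 ≤ 3 * t / τ - 1 := by
      rw [le_sub_iff_add_le, le_div_iff₀ hτ0]; linarith
    simp [hθ, Real.smoothTransition.one_of_one_le this]
  have ha : ContDiff ℝ ∞ fun t => S.radialGain (θ t) := contDiff_radialGain.comp hθs
  have hb : ContDiff ℝ ∞ fun t => S.radialDrift (θ t) := contDiff_radialDrift.comp hθs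
  set R := linearSolution (fun t => S.radialGain (θ t)) (fun t => S.radialDrift (θ t)) ‖z 0‖ with hR
  have hRs : ContDiff ℝ ∞ R := contDiff_linearSolution _ ha hb
  have hRd : ∀ t, HasDerivAt R (S.radialGain (θ t) * R t + S.radialDrift (θ t)) t :=
    hasDerivAt_linearSolution _ ha.continuous hb.continuous
  have hRle : ∀ t ∈ Icc 0 τ, Real.exp (-|S.d|) * (‖z 0‖ / 2) ≤ R t := fun t ht =>
    le_linearSolution _ (fun _ => abs_radialDrift_le _) (fun _ => abs_radialGain_le _) ht.1
      (ht.2.trans hτ1) ((mul_le_mul_of_nonneg_left ht.2 hCE).trans hτ) hρ.le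
  have hR0 : R =ᶠ[𝓝 0] r := by
    refine eventuallyEq_of_linear_ode (b := fun t => S.radialDrift (θ t)) ha.continuous.continuousAt
      (Eventually.of_forall hRd) ?_ (by rw [hr0, hR, linearSolution_zero])
    filter_upwards [hr, hθ0] with t h1 h2
    rwa [h2]
  obtain ⟨h1, h2⟩ := polar_eventuallyEq_ray (S := S) hθ1 (Eventually.of_forall hRd)
  refine ⟨R τ, hRle τ ⟨hτ0.le, le_rfl⟩, _, (((steers_of_isSolutionNear hτ0 fun t ht =>
    isSolutionNear_polarCurve hθs hRs hRd ?_).congr_left ?_ ?_).congr_right h1 h2)⟩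
  · exact (lt_of_lt_of_le (by positivity) (hRle t ht)).ne'
  · exact (polarCurve_congr hθ0 hR0).trans hzr.symm
  · exact (polarControl_congr hθ0 hR0).trans hwr.symm

/-- The radius can be increased to any value along an expanding ray. -/
theorem exists_steers_expanding (ha : 0 < S.radialGain φ) (hb : 0 ≤ S.radialDrift φ) (h₀ : 0 < r₀)
    (h : r₀ < r₁) : ∃ Δ, S.Steers (S.rayCurve φ r₀) (S.rayControl φ r₀) (S.rayCurve φ r₁)
      (S.rayControl φ r₁) Δ := by
  have hr₁ : 0 < r₁ := h₀.trans h
  have hle : ∀ t, 0 ≤ t → r₀ * (1 + S.radialGain φ * t) ≤ S.rayRadius φ r₀ t := fun t ht =>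
    le_linearSolution_const hb h₀.le ht
  have hpos : ∀ t, 0 ≤ t → 0 < S.rayRadius φ r₀ t := fun t ht =>
    lt_of_lt_of_le (by positivity) (hle t ht)
  -- At this time the linear lower bound equals `r₀ + r₁`; the intermediate value theorem then gives
  -- the time at which the radius is `r₁`.
  have hT1 : r₁ ≤ S.rayRadius φ r₀ (r₁ / (r₀ * S.radialGain φ)) := by
    refine le_trans ?_ (hle _ (by positivity))
    have : r₀ * (1 + S.radialGain φ * (r₁ / (r₀ * S.radialGain φ))) = r₀ + r₁ := by
      field_simp
    linarith
  obtain ⟨T, hT, hTr⟩ := intermediate_value_Icc (f := S.rayRadius φ r₀)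
    (show 0 ≤ r₁ / (r₀ * S.radialGain φ) by positivity)
    contDiff_rayRadius.continuous.continuousOn ⟨by rw [rayRadius_zero]; exact h.le, hT1⟩
  have hT0 : 0 < T := hT.1.lt_of_ne fun h0 => by
    rw [← h0, rayRadius_zero] at hTr
    exact h.ne hTr
  obtain ⟨h1, h2⟩ := polar_eventuallyEq_ray (S := S) (ψ := fun _ => φ) (T := T) .rfl
    (Eventually.of_forall (hasDerivAt_rayRadius (S := S) φ r₀))
  rw [hTr] at h1 h2
  exact ⟨_, (steers_of_isSolutionNear hT0 fun t ht =>
    isSolutionNear_ray (hpos t ht.1).ne').congr_right h1 h2⟩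

/-- The gain has period π, while the drift changes sign under a shift by π; one of two opposite
directions therefore serves. -/
theorem exists_expanding (S : PlanarSystem) :
    ∃ φ, S.radialGain φ = |S.d| ∧ 0 ≤ S.radialDrift φ := by
  obtain ⟨φ, hφ⟩ : ∃ φ, S.radialGain φ = |S.d| := by
    rcases le_total 0 S.d with h | h
    · refine ⟨Real.pi / 4, ?_⟩
      rw [radialGain, show 2 * (Real.pi / 4) = Real.pi / 2 by ring, Real.sin_pi_div_two, mul_one,
        abs_of_nonneg h]
    · refine ⟨-(Real.pi / 4), ?_⟩
      rw [radialGain, show 2 * -(Real.pi / 4) = -(Real.pi / 2) by ring, Real.sin_neg,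
        Real.sin_pi_div_two, mul_neg_one, abs_of_nonpos h]
  rcases le_total 0 (S.radialDrift φ) with h | h
  · exact ⟨φ, hφ, h⟩
  · refine ⟨φ + Real.pi, ?_, ?_⟩
    · rw [← hφ, radialGain, radialGain, mul_add, Real.sin_add_two_pi]
    · rw [radialDrift, Real.cos_add_pi, Real.sin_add_pi]
      rw [radialDrift] at h
      linarith

theorem Steers.of_reverse {Δ : ℝ}
    (h : S.reverse.Steers (fun t => z₁ (-t)) (fun t => -w₁ (-t)) z w Δ) :
    S.Steers (fun t => z (-t)) (fun t => -w (-t)) z₁ w₁ (-Δ) := by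
  simpa using h.reverse

/-- The radius can be decreased to any positive value along a contracting ray. -/
theorem exists_steers_contracting (ha : 0 < S.reverse.radialGain φ)
    (hb : 0 ≤ S.reverse.radialDrift φ) (h₁ : 0 < r₁) (h : r₁ < r₀) :
    ∃ Δ, S.Steers (S.rayCurve φ r₀) (S.rayControl φ r₀) (S.rayCurve φ r₁)
      (S.rayControl φ r₁) Δ := by
  obtain ⟨Δ, hΔ⟩ := exists_steers_expanding ha hb h₁ h
  have h2 := hΔ.reverse
  rw [reverse_reverse] at h2
  exact ⟨-Δ, (h2.congr_left (reverse_ray_eventuallyEq _ _).1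
    (reverse_ray_eventuallyEq _ _).2).congr_right (reverse_ray_eventuallyEq _ _).1
    (reverse_ray_eventuallyEq _ _).2⟩

/-- Any two states other than the origin can be joined, whatever the germs of the control there. -/
theorem exists_steers (hd : S.d ≠ 0) (h₀ : S.IsSolutionNear z₀ w₀ 0) (hz₀ : z₀ 0 ≠ 0)
    (h₁ : S.IsSolutionNear z₁ w₁ 0) (hz₁ : z₁ 0 ≠ 0) : ∃ Δ, S.Steers z₀ w₀ z₁ w₁ Δ := by
  have hd' : 0 < |S.d| := abs_pos.2 hd
  obtain ⟨φ, hφ, hφ'⟩ := S.exists_expanding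
  obtain ⟨θ, hθ, hθ'⟩ := S.reverse.exists_expanding
  have hrd : |S.reverse.d| = |S.d| := abs_neg _
  have hk : 0 < Real.exp (-|S.d|) := Real.exp_pos _
  set k := Real.exp (-|S.d|)
  obtain ⟨r₁, hr₁, Δ₁, hs₁⟩ := h₀.exists_steers_ray hz₀ φ
  have hr₁0 : 0 < r₁ := lt_of_lt_of_le (by positivity) hr₁
  have h₁' : S.reverse.IsSolutionNear (fun t => z₁ (-t)) (fun t => -w₁ (-t)) 0 := by
    simpa using IsSolutionNear.reverse (t := 0) 0 (by simpa using h₁)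
  obtain ⟨r₄, hr₄, Δ₄, hs₄⟩ := h₁'.exists_steers_ray (by simpa using hz₁) θ
  have hr₄0 : 0 < r₄ := lt_of_lt_of_le (mul_pos (Real.exp_pos _) (by simpa using hz₁)) hr₄
  -- Turning from radius `r₂` onto the contracting ray leaves at least `k * r₂ / 2`, which exceeds
  -- `r₄ + 1`. The radius can then be brought down to `r₄`, where the time-reversed turn from `z₁`
  -- begins.
  set r₂ := r₁ + 2 * (r₄ + 1) / k with hr₂
  have hr₂1 : r₁ < r₂ := by rw [hr₂]; linarith [show 0 < 2 * (r₄ + 1) / k by positivity]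
  obtain ⟨Δ₂, hs₂⟩ := exists_steers_expanding (hφ ▸ hd') hφ' hr₁0 hr₂1
  have hr₂0 := hr₁0.trans hr₂1
  obtain ⟨r₃, hr₃, Δ₃, hs₃⟩ := IsSolutionNear.exists_steers_ray (S := S)
    (isSolutionNear_ray (by rw [rayRadius_zero]; exact hr₂0.ne'))
    (rayCurve_zero_ne_zero (φ := φ) hr₂0) θ
  rw [norm_rayCurve_zero hr₂0.le] at hr₃
  have hr₃4 : r₄ < r₃ := by
    have h1 : k * (2 * (r₄ + 1) / k) = 2 * (r₄ + 1) := mul_div_cancel₀ _ hk.ne'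
    have h2 : 0 < k * r₁ := mul_pos hk hr₁0
    have h3 : k * (r₂ / 2) = (k * r₁ + k * (2 * (r₄ + 1) / k)) / 2 := by rw [hr₂]; ring
    linarith
  obtain ⟨Δ₅, hs₅⟩ := exists_steers_contracting (S := S) (by rw [hθ, hrd]; exact hd') hθ' hr₄0 hr₃4
  have hs₆ := hs₄.of_reverse.congr_left (reverse_ray_eventuallyEq _ _).1
    (reverse_ray_eventuallyEq _ _).2
  exact ⟨_, (((hs₁.trans hs₂).trans hs₃).trans hs₅).trans hs₆⟩

/-- A relative equilibrium with nonzero control. -/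
theorem exists_equilibrium (hs : |S.d| < |S.s|) :
    ∃ φ r, 0 < r ∧ S.radialGain φ * r + S.radialDrift φ = 0 ∧ S.angularRate φ r ≠ 0 := by
  -- At this radius the tangential drift divided by `r` is smaller than `|s| - |d|`, so it cannot
  -- cancel the rest of `angularRate`.
  set r := (|S.c.re| + |S.c.im| + 1) / (|S.s| - |S.d|) with hr
  have hsd : 0 < |S.s| - |S.d| := sub_pos.2 hs
  have hr0 : 0 < r := by positivity
  obtain ⟨φ₁, h₁, h₁'⟩ := S.exists_expanding
  obtain ⟨φ₂, h₂, h₂'⟩ := S.reverse.exists_expanding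
  -- The radial velocity is nonpositive at `φ₂` and nonnegative at `φ₁`.
  obtain ⟨φ, hφ⟩ := mem_range_of_exists_le_of_exists_ge (c := 0)
    (f := fun φ => S.radialGain φ * r + S.radialDrift φ)
    ((contDiff_radialGain.continuous.mul continuous_const).add contDiff_radialDrift.continuous)
    ⟨φ₂, by
      have h3 : S.radialGain φ₂ = -|S.d| := by
        simp only [radialGain, reverse, abs_neg] at h₂ ⊢; linarith
      have h4 : S.radialDrift φ₂ ≤ 0 := by
        simp only [radialDrift, reverse, Complex.neg_re, Complex.neg_im] at h₂' ⊢; linarith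
      have := mul_nonneg (abs_nonneg S.d) hr0.le
      simp only [h3]; linarith⟩
    ⟨φ₁, by
      have := mul_nonneg (abs_nonneg S.d) hr0.le
      simp only [h₁]; linarith⟩
  refine ⟨φ, r, hr0, hφ, fun h0 => ?_⟩
  have h5 : |S.c.im * Real.cos φ - S.c.re * Real.sin φ| ≤ |S.c.re| + |S.c.im| := by
    refine (abs_sub _ _).trans ?_
    rw [abs_mul, abs_mul, add_comm]
    exact add_le_add (mul_le_of_le_one_right (abs_nonneg _) (Real.abs_sin_le_one _))
      (mul_le_of_le_one_right (abs_nonneg _) (Real.abs_cos_le_one _))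
  have h6 : |(S.c.im * Real.cos φ - S.c.re * Real.sin φ) / r| < |S.s| - |S.d| := by
    rw [abs_div, abs_of_pos hr0, div_lt_iff₀ hr0, hr, mul_div_cancel₀ _ hsd.ne']
    linarith
  have h7 : |S.d * Real.cos (2 * φ)| ≤ |S.d| := by
    rw [abs_mul]
    exact mul_le_of_le_one_right (abs_nonneg _) (Real.abs_cos_le_one _)
  have h8 : S.s = -(S.d * Real.cos (2 * φ) +
      (S.c.im * Real.cos φ - S.c.re * Real.sin φ) / r) := by
    rw [angularRate] at h0; linarith
  have h9 := abs_add_le (S.d * Real.cos (2 * φ)) ((S.c.im * Real.cos φ - S.c.re * Real.sin φ) / r)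
  rw [← abs_neg, ← h8] at h9
  linarith

/-- The integral of the control can be prescribed modulo `2π`. -/
theorem exists_steers_integral (hd : S.d ≠ 0) (hs : |S.d| < |S.s|)
    (h₀ : S.IsSolutionNear z₀ w₀ 0) (hz₀ : z₀ 0 ≠ 0)
    (h₁ : S.IsSolutionNear z₁ w₁ 0) (hz₁ : z₁ 0 ≠ 0) (Δ : ℝ) :
    ∃ k : ℤ, S.Steers z₀ w₀ z₁ w₁ (Δ + 2 * Real.pi * k) := by
  obtain ⟨φ, r, hr, hφr, hν⟩ := exists_equilibrium hs
  set ν := S.angularRate φ r with hν'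
  have hw : S.polarControl (fun _ => φ) (fun _ => r) = fun _ => ν := by
    funext t; simp [polarControl, hν']
  have he : ∀ t, S.IsSolutionNear (polarCurve (fun _ => φ) fun _ => r) (fun _ => ν) t := fun t => by
    rw [← hw]
    exact isSolutionNear_polarCurve contDiff_const contDiff_const
      (fun t => by rw [hφr]; exact hasDerivAt_const t r) hr.ne'
  have hez : polarCurve (fun _ => φ) (fun _ => r) 0 ≠ 0 := by
    simpa [rayCurve, polarCurve] using rayCurve_zero_ne_zero (S := S) (φ := φ) hr
  obtain ⟨Δ₁, hs₁⟩ := exists_steers hd h₀ hz₀ (he 0) hez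
  obtain ⟨Δ₂, hs₂⟩ := exists_steers hd (he 0) hez h₁ hz₁
  have hwait : ∀ τ > 0, S.Steers (polarCurve (fun _ => φ) fun _ => r) (fun _ => ν)
      (polarCurve (fun _ => φ) fun _ => r) (fun _ => ν) (ν * τ) := fun τ hτ => by
    have := steers_of_isSolutionNear hτ fun t _ => he t
    rw [intervalIntegral.integral_const, smul_eq_mul, sub_zero, mul_comm] at this
    exact this
  -- Waiting for time `τ` adds `ν * τ`, a quantity of fixed sign; whole turns are added or removed
  -- until the waiting time is positive.
  obtain ⟨k, τ, hτ, hk⟩ : ∃ (k : ℤ) (τ : ℝ), 0 < τ ∧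
      ν * τ = Δ + 2 * Real.pi * k - Δ₁ - Δ₂ := by
    set y := (Δ₁ + Δ₂ - Δ) / (2 * Real.pi) with hy
    have hy' : 2 * Real.pi * y = Δ₁ + Δ₂ - Δ := mul_div_cancel₀ _ (by positivity)
    have key : ∀ k : ℤ, ν * (2 * Real.pi * (k - y) / ν) = Δ + 2 * Real.pi * k - Δ₁ - Δ₂ := by
      intro k
      rw [mul_div_cancel₀ _ hν, mul_sub, hy']
      ring
    rcases hν.lt_or_gt with h | h
    · obtain ⟨k, hk⟩ := exists_int_lt y
      refine ⟨k, _, div_pos_of_neg_of_neg ?_ h, key k⟩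
      exact mul_neg_of_pos_of_neg (by positivity) (sub_neg.2 hk)
    · obtain ⟨k, hk⟩ := exists_int_gt y
      exact ⟨k, _, div_pos (mul_pos (by positivity) (sub_pos.2 hk)) h, key k⟩
  refine ⟨k, ?_⟩
  have := (hs₁.trans (hwait τ hτ)).trans hs₂
  rwa [hk, show Δ₁ + (Δ + 2 * Real.pi * k - Δ₁ - Δ₂) + Δ₂ = Δ + 2 * Real.pi * k by ring] at this

/-- The linear extension of the vector field, for constant control, to one more dimension. -/
noncomputable def fieldCLM (S : PlanarSystem) (w : ℝ) : ℂ × ℝ →L[ℝ] ℂ × ℝ :=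
  LinearMap.toContinuousLinearMap
    { toFun := fun p => (Complex.I * S.d * conj p.1 + p.2 * S.c - Complex.I * (w - S.s) * p.1, 0)
      map_add' := fun p q => by
        ext
        · simp only [Prod.fst_add, Prod.snd_add, map_add, Complex.ofReal_add]; ring
        · simp
      map_smul' := fun a p => by
        ext
        · simp only [Prod.smul_fst, Prod.smul_snd, Complex.real_smul, map_mul, Complex.conj_ofReal,
            smul_eq_mul, Complex.ofReal_mul, RingHom.id_apply]
          ring
        · simp }

/-- For constant control there is a global trajectory through each point. -/
theorem exists_isSolutionNear_const (S : PlanarSystem) (w : ℝ) (z₀ : ℂ) :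
    ∃ z : ℝ → ℂ, z 0 = z₀ ∧ ∀ t, S.IsSolutionNear z (fun _ => w) t := by
  -- The extra coordinate remains 1 and turns the affine equation into a linear one, solved by the
  -- exponential.
  set X : ℝ → ℂ × ℝ := fun t => NormedSpace.exp (t • S.fieldCLM w) (z₀, 1) with hX
  have hXd : ∀ t, HasDerivAt X (S.fieldCLM w (X t)) t := fun t =>
    ((hasDerivAt_exp_smul_const' (S.fieldCLM w) t).clm_apply (hasDerivAt_const t (z₀, (1 : ℝ)))).congr_deriv
      (by simp [hX])
  have hX0 : X 0 = (z₀, 1) := by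
    simp only [hX]
    rw [zero_smul ℝ (S.fieldCLM w), NormedSpace.exp_zero, one_apply_eq_self]
  have hX2 : ∀ t, (X t).2 = 1 := fun t => by
    have h : ∀ t, HasDerivAt (fun t => (X t).2) 0 t := fun t =>
      (ContinuousLinearMap.snd ℝ ℂ ℝ).hasFDerivAt.comp_hasDerivAt t (hXd t)
    rw [is_const_of_deriv_eq_zero (fun t => (h t).differentiableAt) (fun t => (h t).deriv) t 0, hX0]
  have hXs : ContDiff ℝ ∞ X := by
    have h : ContDiff ℝ ∞ (NormedSpace.exp : (ℂ × ℝ →L[ℝ] ℂ × ℝ) → _) :=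
      contDiff_iff_contDiffAt.2 fun x => (NormedSpace.exp_analytic (𝕂 := ℝ) x).contDiffAt
    exact (h.comp (contDiff_id.smul contDiff_const)).clm_apply contDiff_const
  refine ⟨fun t => (X t).1, congrArg Prod.fst hX0, fun t => Eventually.of_forall fun τ =>
    ⟨hXs.contDiffAt.fst, contDiffAt_const, ?_⟩⟩
  refine ((ContinuousLinearMap.fst ℝ ℂ ℝ).hasFDerivAt.comp_hasDerivAt τ (hXd τ)).congr_deriv ?_
  simp [fieldCLM, field, hX2]

/-- A trajectory with constant control from `z₀`, which leaves the origin if it starts there. -/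
theorem exists_steers_leaving_origin (S : PlanarSystem) (w : ℝ) {z₀ : ℂ} (h : S.c = 0 → z₀ ≠ 0) :
    ∃ z z₁ : ℝ → ℂ, z 0 = z₀ ∧ z₁ 0 ≠ 0 ∧ S.IsSolutionNear z₁ (fun _ => w) 0 ∧
      ∃ Δ, S.Steers z (fun _ => w) z₁ (fun _ => w) Δ := by
  obtain ⟨z, hz0, hz⟩ := S.exists_isSolutionNear_const w z₀
  -- At the origin the velocity is `c ≠ 0`, so the zero is isolated in time.
  have hne : ∀ᶠ t in 𝓝[>] 0, z t ≠ 0 := by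
    by_cases h0 : z₀ = 0
    · have hd := (hz 0).self_of_nhds.2.2
      refine (hd.eventually_ne ?_).filter_mono (nhdsWithin_mono _ fun t ht => ne_of_gt ht)
      rw [hz0, h0]
      simpa [field] using fun hc => h hc h0
    · exact ((hz 0).self_of_nhds.1.continuousAt.eventually_ne (by rwa [hz0])).filter_mono
        nhdsWithin_le_nhds
  obtain ⟨T, hT, hT0⟩ := (hne.and self_mem_nhdsWithin).exists
  exact ⟨z, fun t => z (T + t), hz0, by simpa using hT, (hz (T + 0)).comp_const_add T,
    _, steers_of_isSolutionNear hT0 fun t _ => hz t⟩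

/-- Controllability of the planar system, with prescribed initial control and prescribed integral
of the control modulo `2π`. -/
theorem exists_trajectory (hd : S.d ≠ 0) (hs : |S.d| < |S.s|) {z₀ z₁ : ℂ} (h₀ : S.c = 0 → z₀ ≠ 0)
    (h₁ : S.c = 0 → z₁ ≠ 0) (w₀ Δ : ℝ) :
    ∃ T > 0, ∃ z w, (∀ t ∈ Icc 0 T, S.IsSolutionNear z w t) ∧ z 0 = z₀ ∧ w 0 = w₀ ∧ z T = z₁ ∧
      ∃ k : ℤ, ∫ t in (0 : ℝ)..T, w t = Δ + 2 * Real.pi * k := by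
  obtain ⟨x, x', hx, hx'0, hx', Δ₁, hs₁⟩ := S.exists_steers_leaving_origin w₀ h₀
  -- The last leg is built backwards from `z₁`. The final control is not prescribed, and 0 is an
  -- arbitrary choice.
  obtain ⟨y, y', hy, hy'0, hy', Δ₂, hs₂⟩ := S.reverse.exists_steers_leaving_origin 0
    (z₀ := z₁) (fun h => h₁ (by simpa [reverse] using h))
  have hs₃ := hs₂.reverse
  rw [reverse_reverse] at hs₃
  -- The first leg contributes `Δ₁` and the reversed last leg `-Δ₂`.
  obtain ⟨k, hk⟩ := exists_steers_integral hd hs hx' hx'0 hs₃.isSolutionNear_left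
    (by simpa using hy'0) (Δ - Δ₁ + Δ₂)
  obtain ⟨T, hT, z, w, hsol, hz0, hw0, hzT, -, hi⟩ := (hs₁.trans hk).trans hs₃
  refine ⟨T, hT, z, w, hsol, hz0.eq_of_nhds.trans hx, hw0.eq_of_nhds, ?_, k, hi.trans (by ring)⟩
  simpa [hy] using hzT.eq_of_nhds

end PlanarSystem

/-! ### Reduction of the body to the planar system -/

namespace BodyInFluid

open Filter Set
open scoped Topology

noncomputable section

variable (B : BodyInFluid)

theorem a₁_pos : 0 < B.a₁ := by
  have := B.M_pos; have := B.m_pos; have := B.mr_pos; have := B.lam₁_nonneg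
  unfold a₁; positivity

theorem a₂_pos : 0 < B.a₂ := by
  have := B.M_pos; have := B.m_pos; have := B.mr_pos; have := B.lam₂_nonneg
  unfold a₂; positivity

variable {B} in
theorem lam_ne_zero (hΓ : B.Γ ≠ 0) : B.lam ≠ 0 := mul_ne_zero B.ρ_pos.ne' hΓ

/-- The planar system governing `bodyPoint` on a level set of the momentum integrals, the control
being the angular velocity of the body. -/
def planarSystem : PlanarSystem where
  s := (B.lam / B.a₁ + B.lam / B.a₂) / 2
  d := (B.lam / B.a₂ - B.lam / B.a₁) / 2
  c := ⟨B.lam / B.a₁ * (B.ν - B.f / B.a₁), -(B.lam / B.a₂ * (B.g / B.a₂ - B.μ))⟩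

/-- The vector in the body frame from the point `(-c₂ / λ, c₁ / λ)` of the plane to `O₁`, shifted
by the centre of the controlled rotation. -/
def bodyPoint (c₁ c₂ : ℝ) (q : BodyPosition) : ℂ :=
  ⟨(q.x + c₂ / B.lam) * Real.cos q.α + (q.y - c₁ / B.lam) * Real.sin q.α + B.g / B.a₂,
    -((q.x + c₂ / B.lam) * Real.sin q.α) + (q.y - c₁ / B.lam) * Real.cos q.α - B.f / B.a₁⟩

/-- For given `α` this inverts `bodyPoint`. -/
def positionOf (c₁ c₂ : ℝ) (z : ℂ) (α : ℝ) : BodyPosition where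
  x := (z.re - B.g / B.a₂) * Real.cos α - (z.im + B.f / B.a₁) * Real.sin α - c₂ / B.lam
  y := (z.re - B.g / B.a₂) * Real.sin α + (z.im + B.f / B.a₁) * Real.cos α + c₁ / B.lam
  α := α

/-- These are the momentum integrals solved for `v₁`, `v₂`; their values enter only through `z`. -/
def velocityOf (z : ℂ) (ω : ℝ) : BodyVelocity where
  v₁ := (B.lam * (B.ν - (z.im + B.f / B.a₁)) - B.f * ω) / B.a₁
  v₂ := (B.lam * (B.μ + (z.re - B.g / B.a₂)) - B.g * ω) / B.a₂
  ω := ω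

/-- The angular velocity of the rotor that gives `K` the value `k`. -/
def rotorOf (c₁ c₂ k : ℝ) (q : BodyPosition) (w : BodyVelocity) : ℝ :=
  (k - B.lam / 2 * (q.x ^ 2 + q.y ^ 2) - q.x * c₂ + q.y * c₁
    - (B.f * w.v₁ + B.g * w.v₂ + B.b * w.ω)) / B.Ir

variable {B}

theorem planarSystem_d_ne_zero (hΓ : B.Γ ≠ 0) (hlam : B.lam₁ ≠ B.lam₂) : B.planarSystem.d ≠ 0 := by
  have h1 := B.a₁_pos.ne'
  have h2 := B.a₂_pos.ne'
  intro h
  have h3 : B.lam / B.a₂ = B.lam / B.a₁ := by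
    simp only [planarSystem] at h; linarith
  rw [div_eq_div_iff h2 h1] at h3
  have h4 := mul_left_cancel₀ (lam_ne_zero hΓ) h3
  unfold a₁ a₂ at h4
  exact hlam (by linarith)

theorem planarSystem_abs_lt (hΓ : B.Γ ≠ 0) : |B.planarSystem.d| < |B.planarSystem.s| := by
  rw [← sq_lt_sq, ← sub_pos]
  have h : B.planarSystem.s ^ 2 - B.planarSystem.d ^ 2 = B.lam ^ 2 / (B.a₁ * B.a₂) := by
    simp only [planarSystem]
    have h1 := B.a₁_pos.ne'
    have h2 := B.a₂_pos.ne'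
    field_simp
    ring
  rw [h]
  exact div_pos (by have := lam_ne_zero hΓ; positivity) (mul_pos B.a₁_pos B.a₂_pos)

theorem balanced_of_planarSystem_c_eq_zero (hΓ : B.Γ ≠ 0) (h : B.planarSystem.c = 0) :
    B.Balanced := by
  have h1 := B.a₁_pos.ne'
  have h2 := B.a₂_pos.ne'
  have hl := lam_ne_zero hΓ
  have hre := congrArg Complex.re h
  have him := congrArg Complex.im h
  simp only [planarSystem, Complex.zero_re, Complex.zero_im, neg_eq_zero, mul_eq_zero, div_eq_zero_iff,
    hl, h1, h2, false_or, sub_eq_zero] at hre him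
  exact ⟨by rw [hre, mul_div_cancel₀ _ h1], by rw [← him, mul_div_cancel₀ _ h2]⟩

@[simp] theorem positionOf_bodyPoint (c₁ c₂ : ℝ) (q : BodyPosition) :
    B.positionOf c₁ c₂ (B.bodyPoint c₁ c₂ q) q.α = q := by
  have h := Real.sin_sq_add_cos_sq q.α
  obtain ⟨x, y, α⟩ := q
  simp only [positionOf, bodyPoint, BodyPosition.mk.injEq, and_true]
  constructor
  · linear_combination (x + c₂ / B.lam) * h
  · linear_combination (y - c₁ / B.lam) * h

theorem velocityOf_bodyPoint (hΓ : B.Γ ≠ 0) (q : BodyPosition) (w : BodyVelocity) :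
    B.velocityOf (B.bodyPoint (B.px q w) (B.py q w) q) w.ω = w := by
  have h1 := B.a₁_pos.ne'
  have h2 := B.a₂_pos.ne'
  have hl := lam_ne_zero hΓ
  have h := Real.sin_sq_add_cos_sq q.α
  have hχ : B.χ = B.lam * B.ν := rfl
  have hζ : B.ζ = B.lam * B.μ := rfl
  obtain ⟨v₁, v₂, ω⟩ := w
  simp only [velocityOf, bodyPoint, BodyVelocity.mk.injEq, and_true]
  constructor
  · rw [div_eq_iff h1]
    have h3 : B.lam * (B.px q ⟨v₁, v₂, ω⟩ / B.lam) = B.px q ⟨v₁, v₂, ω⟩ := mul_div_cancel₀ _ hl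
    have h4 : B.lam * (B.py q ⟨v₁, v₂, ω⟩ / B.lam) = B.py q ⟨v₁, v₂, ω⟩ := mul_div_cancel₀ _ hl
    rw [px, P₁, P₂] at h3
    rw [py, P₁, P₂] at h4
    simp only [px, py, P₁, P₂]
    rw [hχ, hζ] at *
    linear_combination (Real.sin q.α) * h4 + (Real.cos q.α) * h3 +
      (B.a₁ * v₁ + B.f * ω - B.lam * B.ν) * h
  · rw [div_eq_iff h2]
    have h3 : B.lam * (B.px q ⟨v₁, v₂, ω⟩ / B.lam) = B.px q ⟨v₁, v₂, ω⟩ := mul_div_cancel₀ _ hl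
    have h4 : B.lam * (B.py q ⟨v₁, v₂, ω⟩ / B.lam) = B.py q ⟨v₁, v₂, ω⟩ := mul_div_cancel₀ _ hl
    rw [px, P₁, P₂] at h3
    rw [py, P₁, P₂] at h4
    simp only [px, py, P₁, P₂]
    rw [hχ, hζ] at *
    linear_combination (Real.cos q.α) * h4 - (Real.sin q.α) * h3 +
      (B.a₂ * v₂ + B.g * ω - B.lam * B.μ) * h

theorem atCentre_of_bodyPoint_eq_zero (hb : B.Balanced) {c₁ c₂ : ℝ} {q : BodyPosition}
    (h : B.bodyPoint c₁ c₂ q = 0) : B.AtCentre c₁ c₂ q := by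
  have h1 := B.a₁_pos.ne'
  have h2 := B.a₂_pos.ne'
  have hf : B.f / B.a₁ = B.ν := by rw [← hb.1, mul_div_cancel_left₀ _ h1]
  have hg : B.g / B.a₂ = B.μ := by rw [← hb.2, mul_div_cancel_left₀ _ h2]
  have hq := B.positionOf_bodyPoint c₁ c₂ q
  rw [h] at hq
  have hx := congrArg BodyPosition.x hq
  have hy := congrArg BodyPosition.y hq
  simp only [positionOf, Complex.zero_re, Complex.zero_im, hf, hg] at hx hy
  constructor
  · rw [← hx]; ring
  · rw [← hy]; ring

@[simp] theorem P₁_velocityOf (z : ℂ) (ω : ℝ) :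
    B.P₁ (B.velocityOf z ω) = B.lam * (B.ν - (z.im + B.f / B.a₁)) := by
  rw [P₁, velocityOf, mul_div_cancel₀ _ B.a₁_pos.ne']
  ring

@[simp] theorem P₂_velocityOf (z : ℂ) (ω : ℝ) :
    B.P₂ (B.velocityOf z ω) = B.lam * (B.μ + (z.re - B.g / B.a₂)) := by
  rw [P₂, velocityOf, mul_div_cancel₀ _ B.a₂_pos.ne']
  ring

theorem px_positionOf (hΓ : B.Γ ≠ 0) (c₁ c₂ : ℝ) (z : ℂ) (α ω : ℝ) :
    B.px (B.positionOf c₁ c₂ z α) (B.velocityOf z ω) = c₁ := by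
  have h3 : B.lam * (c₁ / B.lam) = c₁ := mul_div_cancel₀ _ (lam_ne_zero hΓ)
  have hχ : B.χ = B.lam * B.ν := rfl
  have hζ : B.ζ = B.lam * B.μ := rfl
  rw [px, P₁_velocityOf, P₂_velocityOf, positionOf, hχ, hζ]
  linear_combination h3

theorem py_positionOf (hΓ : B.Γ ≠ 0) (c₁ c₂ : ℝ) (z : ℂ) (α ω : ℝ) :
    B.py (B.positionOf c₁ c₂ z α) (B.velocityOf z ω) = c₂ := by
  have h3 : B.lam * (c₂ / B.lam) = c₂ := mul_div_cancel₀ _ (lam_ne_zero hΓ)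
  have hχ : B.χ = B.lam * B.ν := rfl
  have hζ : B.ζ = B.lam * B.μ := rfl
  rw [py, P₁_velocityOf, P₂_velocityOf, positionOf, hχ, hζ]
  linear_combination h3

/-- With this rotor speed `P₃` depends on the position alone, so its derivative follows from the
kinematic relations. -/
theorem P₃_rotorOf (c₁ c₂ k : ℝ) (q : BodyPosition) (w : BodyVelocity) :
    B.P₃ w (B.rotorOf c₁ c₂ k q w) = k - B.lam / 2 * (q.x ^ 2 + q.y ^ 2) - q.x * c₂ + q.y * c₁ := by
  rw [P₃, rotorOf, mul_div_cancel₀ _ B.Ir_pos.ne']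
  ring

theorem rotorOf_K (q : BodyPosition) (w : BodyVelocity) (Ω : ℝ) :
    B.rotorOf (B.px q w) (B.py q w) (B.K q w Ω) q w = Ω := by
  rw [rotorOf, div_eq_iff B.Ir_pos.ne', K, P₃]
  ring

/-- This is the derivative of the radius vector in the rotating frame. The shift by `f / a₁` and `g
/ a₂` absorbs the ω-terms of the velocity, leaving the pure rotation -iωz. -/
theorem field_planarSystem_re (z : ℂ) (ω : ℝ) : (B.planarSystem.field ω z).re =
    (B.velocityOf z ω).v₁ + ω * (z.im + B.f / B.a₁) := by
  simp [PlanarSystem.field, planarSystem, velocityOf]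
  ring

theorem field_planarSystem_im (z : ℂ) (ω : ℝ) : (B.planarSystem.field ω z).im =
    (B.velocityOf z ω).v₂ - ω * (z.re - B.g / B.a₂) := by
  simp [PlanarSystem.field, planarSystem, velocityOf]
  ring

/-- The kinematic relations are the planar equation written in fixed axes. `P₁` and `P₂` are affine
in `z`, so their equations are that same equation again; `P₃` is handled by the choice of rotor
speed. -/
theorem isMotion_of_hasDerivAt (hΓ : B.Γ ≠ 0) (c₁ c₂ k : ℝ) {T : ℝ} {z : ℝ → ℂ} {ω α : ℝ → ℝ}
    (hz : ∀ t ∈ Icc 0 T, HasDerivAt z (B.planarSystem.field (ω t) (z t)) t)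
    (hα : ∀ t, HasDerivAt α (ω t) t) :
    B.IsMotion T
      (fun t => B.rotorOf c₁ c₂ k (B.positionOf c₁ c₂ (z t) (α t)) (B.velocityOf (z t) (ω t)))
      (fun t => B.positionOf c₁ c₂ (z t) (α t)) (fun t => B.velocityOf (z t) (ω t)) := by
  have hre : ∀ t ∈ Icc 0 T, HasDerivAt (fun t => (z t).re)
      ((B.velocityOf (z t) (ω t)).v₁ + ω t * ((z t).im + B.f / B.a₁)) t := fun t ht =>
    field_planarSystem_re (B := B) _ _ ▸ Complex.reCLM.hasFDerivAt.comp_hasDerivAt t (hz t ht)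
  have him : ∀ t ∈ Icc 0 T, HasDerivAt (fun t => (z t).im)
      ((B.velocityOf (z t) (ω t)).v₂ - ω t * ((z t).re - B.g / B.a₂)) t := fun t ht =>
    field_planarSystem_im (B := B) _ _ ▸ Complex.imCLM.hasFDerivAt.comp_hasDerivAt t (hz t ht)
  have hx : ∀ t ∈ Icc 0 T, HasDerivAt (fun t => (B.positionOf c₁ c₂ (z t) (α t)).x)
      ((B.velocityOf (z t) (ω t)).v₁ * Real.cos (α t) -
        (B.velocityOf (z t) (ω t)).v₂ * Real.sin (α t)) t := fun t ht => by
    refine (((((hre t ht).sub_const _).mul (hα t).cos).sub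
      (((him t ht).add_const _).mul (hα t).sin)).sub_const _).congr_deriv ?_
    ring
  have hy : ∀ t ∈ Icc 0 T, HasDerivAt (fun t => (B.positionOf c₁ c₂ (z t) (α t)).y)
      ((B.velocityOf (z t) (ω t)).v₁ * Real.sin (α t) +
        (B.velocityOf (z t) (ω t)).v₂ * Real.cos (α t)) t := fun t ht => by
    refine (((((hre t ht).sub_const _).mul (hα t).sin).add
      (((him t ht).add_const _).mul (hα t).cos)).add_const _).congr_deriv ?_
    ring
  have hχ : B.χ = B.lam * B.ν := rfl
  have hζ : B.ζ = B.lam * B.μ := rfl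
  refine ⟨fun t ht => (hx t ht).hasDerivWithinAt, fun t ht => (hy t ht).hasDerivWithinAt,
    fun t _ => (hα t).hasDerivWithinAt, fun t ht => ?_, fun t ht => ?_, fun t ht => ?_⟩
  · simp only [P₁_velocityOf, P₂_velocityOf]
    refine ((((him t ht).add_const _).const_sub _).const_mul _).hasDerivWithinAt.congr_deriv ?_
    rw [hζ, show (B.velocityOf (z t) (ω t)).ω = ω t from rfl]
    ring
  · simp only [P₁_velocityOf, P₂_velocityOf]
    refine ((((hre t ht).sub_const _).const_add _).const_mul _).hasDerivWithinAt.congr_deriv ?_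
    rw [hχ, show (B.velocityOf (z t) (ω t)).ω = ω t from rfl]
    ring
  · simp only [P₃_rotorOf, P₁_velocityOf, P₂_velocityOf]
    refine ((((((hx t ht).pow 2).add ((hy t ht).pow 2)).const_mul (B.lam / 2)).const_sub k).sub
      ((hx t ht).mul_const c₂)).add ((hy t ht).mul_const c₁) |>.hasDerivWithinAt.congr_deriv ?_
    have h := Real.sin_sq_add_cos_sq (α t)
    have h3 : B.lam * (c₁ / B.lam) = c₁ := mul_div_cancel₀ _ (lam_ne_zero hΓ)
    have h4 : B.lam * (c₂ / B.lam) = c₂ := mul_div_cancel₀ _ (lam_ne_zero hΓ)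
    rw [hχ, hζ]
    generalize hv₁ : (B.velocityOf (z t) (ω t)).v₁ = v₁
    generalize hv₂ : (B.velocityOf (z t) (ω t)).v₂ = v₂
    simp only [positionOf]
    push_cast
    linear_combination (-(B.lam * (v₁ * ((z t).re - B.g / B.a₂) + v₂ * ((z t).im + B.f / B.a₁)))) * h
      + (v₁ * Real.cos (α t) - v₂ * Real.sin (α t)) * h4
      - (v₁ * Real.sin (α t) + v₂ * Real.cos (α t)) * h3

theorem contDiff_rotorOf (c₁ c₂ k : ℝ) {z : ℝ → ℂ} {ω α : ℝ → ℝ} (hz : ContDiff ℝ (⊤ : ℕ∞) z)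
    (hω : ContDiff ℝ (⊤ : ℕ∞) ω) (hα : ContDiff ℝ (⊤ : ℕ∞) α) : ContDiff ℝ (⊤ : ℕ∞) fun t =>
      B.rotorOf c₁ c₂ k (B.positionOf c₁ c₂ (z t) (α t)) (B.velocityOf (z t) (ω t)) := by
  have hre : ContDiff ℝ (⊤ : ℕ∞) fun t => (z t).re := Complex.reCLM.contDiff.comp hz
  have him : ContDiff ℝ (⊤ : ℕ∞) fun t => (z t).im := Complex.imCLM.contDiff.comp hz
  simp only [rotorOf, positionOf, velocityOf]
  fun_prop

end

end BodyInFluid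

/-! ### Lifting the planar trajectory to a motion of the body -/

theorem theorem1 (B : BodyInFluid) (hΓ : B.Γ ≠ 0) (hlam : B.lam₁ ≠ B.lam₂)
    (q₀ q₁ : BodyPosition) (w₀ : BodyVelocity) (Ω₀ : ℝ)
    (hq : B.Balanced → ¬ B.AtCentre (B.px q₀ w₀) (B.py q₀ w₀) q₀ ∧
      ¬ B.AtCentre (B.px q₀ w₀) (B.py q₀ w₀) q₁) :
    ∃ T : ℝ, 0 < T ∧ ∃ Ω : ℝ → ℝ, ContDiff ℝ (⊤ : ℕ∞) Ω ∧ Ω 0 = Ω₀ ∧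
      ∃ (q : ℝ → BodyPosition) (w : ℝ → BodyVelocity),
        B.IsMotion T Ω q w ∧ q 0 = q₀ ∧ w 0 = w₀ ∧
        (∀ t ∈ Set.Icc 0 T, B.px (q t) (w t) = B.px q₀ w₀ ∧ B.py (q t) (w t) = B.py q₀ w₀ ∧
          B.K (q t) (w t) (Ω t) = B.K q₀ w₀ Ω₀) ∧
        (q T).x = q₁.x ∧ (q T).y = q₁.y ∧ ((q T).α : Real.Angle) = (q₁.α : Real.Angle) := by
  set c₁ := B.px q₀ w₀ with hc₁
  set c₂ := B.py q₀ w₀ with hc₂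
  obtain ⟨T, hT, z, ω, hsol, hz0, hω0, hzT, k, hk⟩ := PlanarSystem.exists_trajectory
    (BodyInFluid.planarSystem_d_ne_zero hΓ hlam) (BodyInFluid.planarSystem_abs_lt hΓ)
    (z₀ := B.bodyPoint c₁ c₂ q₀) (z₁ := B.bodyPoint c₁ c₂ q₁)
    (fun hc h =>
      have hb := BodyInFluid.balanced_of_planarSystem_c_eq_zero hΓ hc
      (hq hb).1 (BodyInFluid.atCentre_of_bodyPoint_eq_zero hb h))
    (fun hc h =>
      have hb := BodyInFluid.balanced_of_planarSystem_c_eq_zero hΓ hc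
      (hq hb).2 (BodyInFluid.atCentre_of_bodyPoint_eq_zero hb h)) w₀.ω (q₁.α - q₀.α)
  -- The planar trajectory is smooth only near [0, T]; global extensions of state and control make Ω
  -- smooth on the whole line.
  obtain ⟨Z, hZ, hZz⟩ := exists_contDiff_extension (s := Set.Icc 0 T) isCompact_Icc
    fun t ht => (hsol t ht).mono fun τ h => h.1
  obtain ⟨W, hW, hWω⟩ := exists_contDiff_extension (s := Set.Icc 0 T) isCompact_Icc
    fun t ht => (hsol t ht).mono fun τ h => h.2.1
  have h0 : (0 : ℝ) ∈ Set.Icc 0 T := ⟨le_rfl, hT.le⟩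
  have hT' : T ∈ Set.Icc 0 T := ⟨hT.le, le_rfl⟩
  have hZ0 : Z 0 = B.bodyPoint c₁ c₂ q₀ := (hZz 0 h0).eq_of_nhds.trans hz0
  have hW0 : W 0 = w₀.ω := (hWω 0 h0).eq_of_nhds.trans hω0
  have hZT : Z T = B.bodyPoint c₁ c₂ q₁ := (hZz T hT').eq_of_nhds.trans hzT
  set α : ℝ → ℝ := fun t => q₀.α + ∫ u in (0 : ℝ)..t, W u with hα
  have hαd : ∀ t, HasDerivAt α (W t) t := fun t =>
    (hasDerivAt_integral_of_continuous hW.continuous 0 t).const_add _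
  have hα0 : α 0 = q₀.α := by simp [hα]
  have hαT : α T = q₁.α + k * (2 * Real.pi) := by
    have : ∫ u in (0 : ℝ)..T, W u = ∫ u in (0 : ℝ)..T, ω u :=
      intervalIntegral.integral_congr fun t ht =>
        (hWω t (by rwa [Set.uIcc_of_le hT.le] at ht)).eq_of_nhds
    simp only [hα, this, hk]
    ring
  have hq0 : B.positionOf c₁ c₂ (Z 0) (α 0) = q₀ := by rw [hZ0, hα0, B.positionOf_bodyPoint]
  have hw0 : B.velocityOf (Z 0) (W 0) = w₀ := by
    rw [hZ0, hW0, hc₁, hc₂, BodyInFluid.velocityOf_bodyPoint hΓ]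
  have hend := B.positionOf_bodyPoint c₁ c₂ q₁
  refine ⟨T, hT, _, BodyInFluid.contDiff_rotorOf c₁ c₂ (B.K q₀ w₀ Ω₀) hZ hW
    (contDiff_infty_of_hasDerivAt hαd hW), ?_, _, _,
    BodyInFluid.isMotion_of_hasDerivAt hΓ c₁ c₂ _ (fun t ht => ?_) hαd, hq0, hw0,
    fun t _ => ⟨BodyInFluid.px_positionOf hΓ .., BodyInFluid.py_positionOf hΓ .., ?_⟩, ?_, ?_, ?_⟩
  · simp only [hq0, hw0]
    exact BodyInFluid.rotorOf_K q₀ w₀ Ω₀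
  · have h := (hsol t ht).self_of_nhds.2.2.congr_of_eventuallyEq (hZz t ht)
    rwa [← (hZz t ht).eq_of_nhds, ← (hWω t ht).eq_of_nhds] at h
  · rw [BodyInFluid.K, BodyInFluid.P₃_rotorOf, BodyInFluid.px_positionOf hΓ,
      BodyInFluid.py_positionOf hΓ]
    ring
  · rw [← congrArg BodyPosition.x hend, hZT, hαT]
    simp only [BodyInFluid.positionOf, Real.cos_add_int_mul_two_pi, Real.sin_add_int_mul_two_pi]
  · rw [← congrArg BodyPosition.y hend, hZT, hαT]
    simp only [BodyInFluid.positionOf, Real.cos_add_int_mul_two_pi, Real.sin_add_int_mul_two_pi]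
  · change ((α T : ℝ) : Real.Angle) = _
    rw [Real.Angle.angle_eq_iff_two_pi_dvd_sub]
    exact ⟨k, by rw [hαT]; ring⟩
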